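/- Notation. $\mathbb{N}=\{0,1,2,\dots\}$, except that weight systems $(v_n)$ are indexed by $n\ge 1$; $C^\infty(\mathbb{R}^d)$ is the space of complex-valued smooth functions. A weight sequence is a sequence $(M_p)_{p\in\mathbb{N}}$ of positive real numbers with $M_{p+1}/M_p\to\infty$. It satisfies $(M.1)$ if $M_p^2\le M_{p-1}M_{p+1}$ for all $p\ge 1$, and $(M.2)'$ if there are $C_0,H\ge 1$ with $M_{p+1}\le C_0H^pM_p$ for all $p\in\mathbb{N}$. The associated function of a weight sequence $(A_p)$ is $A(t)=\sup_{p\in\mathbb{N}}\log(t^pA_0/A_p)$ for $t>0$, $A(0)=0$, and $A(x)=A(|x|)$ for $x\in\mathbb{R}^d$. For weight sequences $M_p$, $A_p$, the Gelfand–Shilov space of Beurling type $\mathcal{S}^{(M_p)}_{(A_p)}(\mathbb{R}^d)$ consists of all $\varphi\in C^\infty(\mathbb{R}^d)$ such that $$\sup_{\alpha\in\mathbb{N}^d}\sup_{x\in\mathbb{R}^d}\frac{h^{|\alpha|}|\partial^\alpha\varphi(x)|e^{A(\tau x)}}{M_{|\alpha|}}<\infty\quad\text{for all } h,\tau>0.$$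 A decreasing weight system is a pointwise decreasing sequence $\mathcal{V}=(v_n)_{n\ge1}$ of positive continuous functions on $\mathbb{R}^d$. Its maximal Nachbin family $\overline{V}$ is the set of all non-negative upper semicontinuous functions $v$ on $\mathbb{R}^d$ with $\sup_{x}v(x)/v_n(x)<\infty$ for all $n$. The system $\mathcal{V}$ satisfies $(V)$ if for every sequence $(\lambda_n)_{n\ge1}$ of positive numbers there is $v\in\overline{V}$ such that for every $n\ge1$ there is $N\ge1$ with $\inf\{\lambda_1v_1,\dots,\lambda_Nv_N\}\le\sup\{v_n/n,v\}$ pointwise. It is $A_p$-admissible if there is $\tau>0$ such that for every $n$ there are $m\ge n$ and $C>0$ with $v_m(x+y)\le Cv_n(x)e^{A(\tau y)}$ for all $x,y\in\mathbb{R}^d$. For $n\ge1$ let $E_n$ be the space of all $\varphi\in C^\infty(\mathbb{R}^d)$ with $$\|\varphi\|_n:=\sup_{\alpha\in\mathbb{N}^d}\sup_{x\in\mathbb{R}^d}\frac{n^{-|\alpha|}|\partial^\alpha\varphi(x)|v_n(x)}{M_{|\alpha|}}<\infty ,$$ normed by $\|\cdot\|_n$, and let $\mathcal{B}^{\{M_p\}}_{\mathcal{V}}(\mathbb{R}^d)=\bigcup_{n}E_n$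 carry the locally convex inductive limit topology, that is, the finest locally convex topology for which all inclusions $E_n\to\mathcal{B}^{\{M_p\}}_{\mathcal{V}}(\mathbb{R}^d)$ are continuous. Let $\mathfrak{R}$ be the set of all positive increasing sequences $(r_j)_{j\in\mathbb{N}}$ tending to infinity. Let $\widetilde{\mathcal{B}}^{\{M_p\}}_{\mathcal{V}}(\mathbb{R}^d)$ be the space of all $\varphi\in C^\infty(\mathbb{R}^d)$ such that $$\|\varphi\|_{(r_j),v}:=\sup_{\alpha\in\mathbb{N}^d}\sup_{x\in\mathbb{R}^d}\frac{|\partial^\alpha\varphi(x)|v(x)}{M_{|\alpha|}\prod_{j=0}^{|\alpha|}r_j}<\infty$$ for all $(r_j)\in\mathfrak{R}$ and $v\in\overline{V}$, with the topology generated by the seminorms $\|\cdot\|_{(r_j),v}$, $(r_j)\in\mathfrak{R}$, $v\in\overline{V}$. Theorem. Let $M_p$ and $A_p$ be weight sequences satisfying $(M.1)$ and $(M.2)'$ such that $\mathcal{S}^{(M_p)}_{(A_p)}(\mathbb{R}^d)\ne\{0\}$, and let $\mathcal{V}$ be an $A_p$-admissible decreasing weight system satisfying $(V)$. Then $\mathcal{B}^{\{M_p\}}_{\mathcal{V}}(\mathbb{R}^d)$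 and $\widetilde{\mathcal{B}}^{\{M_p\}}_{\mathcal{V}}(\mathbb{R}^d)$ are equal as sets and have the same topology. -/

import Mathlib

open Filter Topology
open scoped ContDiff

noncomputable section

namespace GelfandShilov

/-! ### Weight sequences -/

/-- A weight sequence: a positive sequence with `M_p / M_{p-1} → ∞`. -/
def IsWeightSequence (M : ℕ → ℝ) : Prop :=
  (∀ p, 0 < M p) ∧ Tendsto (fun p => M (p + 1) / M p) atTop atTop

/-- Condition `(M.1)`: `M_p ^ 2 ≤ M_{p-1} M_{p+1}` for `p ≥ 1` (logarithmic convexity). -/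
def ConditionM1 (M : ℕ → ℝ) : Prop :=
  ∀ p, M (p + 1) ^ 2 ≤ M p * M (p + 2)

/-- Condition `(M.2)'`: `M_{p+1} ≤ C₀ H^p M_p` for all `p`, for some `C₀, H ≥ 1`. -/
def ConditionM2' (M : ℕ → ℝ) : Prop :=
  ∃ C₀ H : ℝ, 1 ≤ C₀ ∧ 1 ≤ H ∧ ∀ p, M (p + 1) ≤ C₀ * H ^ p * M p

/-- The associated function `M(t) = sup_p log (t ^ p M_0 / M_p)` for `t > 0`, and `M(0) = 0`.
For a weight sequence the supremum is over a set that is bounded above. -/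
def assocFun (M : ℕ → ℝ) (t : ℝ) : ℝ :=
  if 0 < t then ⨆ p : ℕ, Real.log (t ^ p * M 0 / M p) else 0

/-- Komatsu's family `ℜ` of positive increasing sequences tending to infinity. -/
def komatsuFamily : Set (ℕ → ℝ) :=
  {r | (∀ j, 0 < r j) ∧ Monotone r ∧ Tendsto r atTop atTop}

/-! ### Weight systems

A sequence of weights `v₁, v₂, …` is coded as `v : ℕ → X → ℝ`, the weight `v_{n+1}` being `v n`. -/

/-- A decreasing weight system: a pointwise decreasing sequence of positive continuous functions. -/
def IsDecreasingWeightSystem {X : Type*} [TopologicalSpace X] (v : ℕ → X → ℝ) : Prop :=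
  (∀ n, Continuous (v n)) ∧ (∀ n x, 0 < v n x) ∧ ∀ n x, v (n + 1) x ≤ v n x

/-- The maximal Nachbin family of `v`: all non-negative upper semicontinuous `u` such that
`sup_x u(x) / v_n(x) < ∞` for every `n`. -/
def nachbinFamily {X : Type*} [TopologicalSpace X] (v : ℕ → X → ℝ) : Set (X → ℝ) :=
  {u | (∀ x, 0 ≤ u x) ∧ UpperSemicontinuous u ∧
    ∀ n, BddAbove (Set.range fun x => u x / v n x)}

/-- Condition `(V)`: for every sequence `(λ_n)` of positive numbers there is `u` in the maximal
Nachbin family such that for every `n` there is `N` with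
`inf {λ₁ v₁, …, λ_N v_N} ≤ sup {v_n / n, u}`.  (Indices are shifted by one.) -/
def ConditionV {X : Type*} [TopologicalSpace X] (v : ℕ → X → ℝ) : Prop :=
  ∀ l : ℕ → ℝ, (∀ n, 0 < l n) → ∃ u ∈ nachbinFamily v, ∀ n, ∃ N : ℕ, ∀ x,
    (Finset.range (N + 1)).inf' Finset.nonempty_range_add_one (fun k => l k * v k x) ≤
      max (v n x / ((n : ℝ) + 1)) (u x)

/-- `A_p`-admissibility: there is `τ > 0` such that for every `n` there are `m ≥ n` and `C > 0`
with `v_m(x + y) ≤ C v_n(x) exp (A(τ y))`, where `A` is extended radially to `ℝ^d`. -/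
def IsAdmissible {d : ℕ} (A : ℕ → ℝ) (v : ℕ → EuclideanSpace ℝ (Fin d) → ℝ) : Prop :=
  ∃ τ : ℝ, 0 < τ ∧ ∀ n, ∃ m, n ≤ m ∧ ∃ C : ℝ, 0 < C ∧
    ∀ x y, v m (x + y) ≤ C * v n x * Real.exp (assocFun A ‖τ • y‖)

/-! ### Smooth functions and partial derivatives -/

/-- The space `C^∞(ℝ^d)` of complex-valued smooth functions. -/
def smoothFunctions (d : ℕ) : Submodule ℂ (EuclideanSpace ℝ (Fin d) → ℂ) where
  carrier := {φ | ContDiff ℝ ∞ φ}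
  add_mem' {f g} hf hg := by
    change ContDiff ℝ ∞ f at hf
    change ContDiff ℝ ∞ g at hg
    exact hf.add hg
  zero_mem' := by
    change ContDiff ℝ ∞ fun _ => (0 : ℂ)
    exact contDiff_const
  smul_mem' c f hf := by
    change ContDiff ℝ ∞ f at hf
    exact hf.const_smul c

theorem smoothFunctions_contDiff {d : ℕ} (φ : smoothFunctions d) : ContDiff ℝ ∞ φ.1 := φ.2

theorem smoothFunctions_differentiable {d : ℕ} (φ : smoothFunctions d) :
    Differentiable ℝ φ.1 :=
  (smoothFunctions_contDiff φ).differentiable (by simp)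

/-- The partial derivative `∂_i` as an endomorphism of `C^∞(ℝ^d)`. -/
def partialD {d : ℕ} (i : Fin d) : Module.End ℂ (smoothFunctions d) where
  toFun φ := ⟨fun x => fderiv ℝ φ.1 x (EuclideanSpace.single i 1),
    ((smoothFunctions_contDiff φ).fderiv_right (m := ∞) (by simp)).clm_apply contDiff_const⟩
  map_add' φ ψ := by
    refine Subtype.ext (funext fun x => ?_)
    have h := fderiv_add (smoothFunctions_differentiable φ x) (smoothFunctions_differentiable ψ x)
    exact congrArg (fun T => T (EuclideanSpace.single i (1 : ℝ))) h
  map_smul' c φ := by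
    refine Subtype.ext (funext fun x => ?_)
    have h := fderiv_const_smul (smoothFunctions_differentiable φ x) c
    exact congrArg (fun T => T (EuclideanSpace.single i (1 : ℝ))) h

/-- `∂^α = ∂_1^{α_1} ⋯ ∂_d^{α_d}` for a multi-index `α`. -/
def multiD {d : ℕ} (α : Fin d → ℕ) : Module.End ℂ (smoothFunctions d) :=
  ((List.finRange d).map fun i => partialD i ^ α i).prod

/-! ### Weighted spaces of smooth functions -/

/-- `sup_α sup_x c_{|α|} |∂^α φ(x)| w(x)`, with values in `[0, ∞]`. -/
def weightedSup {d : ℕ} (c : ℕ → ℝ) (w : EuclideanSpace ℝ (Fin d) → ℝ)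
    (φ : smoothFunctions d) : ENNReal :=
  ⨆ (α : Fin d → ℕ) (x : EuclideanSpace ℝ (Fin d)),
    ENNReal.ofReal (c (∑ i, α i) * ‖(multiD α φ).1 x‖ * w x)

section

variable {d : ℕ} (c : ℕ → ℝ) (w : EuclideanSpace ℝ (Fin d) → ℝ)

theorem weightedSup_add_le (φ ψ : smoothFunctions d) :
    weightedSup c w (φ + ψ) ≤ weightedSup c w φ + weightedSup c w ψ := by
  refine iSup₂_le fun α x => ?_
  refine le_trans ?_ (add_le_add
    (le_iSup₂ (f := fun (α : Fin d → ℕ) (x : EuclideanSpace ℝ (Fin d)) =>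
      ENNReal.ofReal (c (∑ i, α i) * ‖(multiD α φ).1 x‖ * w x)) α x)
    (le_iSup₂ (f := fun (α : Fin d → ℕ) (x : EuclideanSpace ℝ (Fin d)) =>
      ENNReal.ofReal (c (∑ i, α i) * ‖(multiD α ψ).1 x‖ * w x)) α x))
  have h : ‖(multiD α (φ + ψ)).1 x‖ ≤ ‖(multiD α φ).1 x‖ + ‖(multiD α ψ).1 x‖ := by
    rw [map_add]
    exact norm_add_le _ _
  rcases le_total 0 (c (∑ i, α i) * w x) with h0 | h0
  · refine le_trans (ENNReal.ofReal_le_ofReal ?_) ENNReal.ofReal_add_le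
    nlinarith [mul_le_mul_of_nonneg_left h h0]
  · rw [ENNReal.ofReal_of_nonpos]
    · exact zero_le
    · nlinarith [mul_nonneg (neg_nonneg.2 h0) (norm_nonneg ((multiD α (φ + ψ)).1 x))]

theorem weightedSup_smul (a : ℂ) (φ : smoothFunctions d) :
    weightedSup c w (a • φ) = ENNReal.ofReal ‖a‖ * weightedSup c w φ := by
  unfold weightedSup
  simp only [ENNReal.mul_iSup]
  refine iSup_congr fun α => iSup_congr fun x => ?_
  rw [← ENNReal.ofReal_mul (norm_nonneg a), map_smul]
  congr 1
  have : ‖(a • multiD α φ).1 x‖ = ‖a‖ * ‖(multiD α φ).1 x‖ :=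
    norm_smul a ((multiD α φ).1 x)
  rw [this]
  ring

/-- The smooth functions `φ` with `sup_α sup_x c_{|α|} |∂^α φ(x)| w(x) < ∞`. -/
def weightedSpace : Submodule ℂ (smoothFunctions d) where
  carrier := {φ | weightedSup c w φ < ⊤}
  add_mem' {φ ψ} hf hg := by
    change weightedSup c w φ < ⊤ at hf
    change weightedSup c w ψ < ⊤ at hg
    exact (weightedSup_add_le c w φ ψ).trans_lt (ENNReal.add_lt_top.2 ⟨hf, hg⟩)
  zero_mem' := by
    have h := weightedSup_smul c w 0 0
    simp only [zero_smul, norm_zero, ENNReal.ofReal_zero, zero_mul] at h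
    change weightedSup c w 0 < ⊤
    rw [h]
    exact ENNReal.zero_lt_top
  smul_mem' a φ hf := by
    change weightedSup c w φ < ⊤ at hf
    change weightedSup c w (a • φ) < ⊤
    rw [weightedSup_smul]
    exact ENNReal.mul_lt_top ENNReal.ofReal_lt_top hf

theorem weightedSup_lt_top (φ : weightedSpace c w) : weightedSup c w φ.1 < ⊤ := φ.2

/-- The (finite) supremum `sup_α sup_x c_{|α|} |∂^α φ(x)| w(x)` as a seminorm on
`weightedSpace c w`. -/
def weightedSeminorm : Seminorm ℂ (weightedSpace c w) :=
  Seminorm.of (fun φ => (weightedSup c w φ.1).toReal)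
    (fun φ ψ => by
      have hφ := weightedSup_lt_top c w φ
      have hψ := weightedSup_lt_top c w ψ
      rw [← ENNReal.toReal_add hφ.ne hψ.ne]
      exact ENNReal.toReal_mono (ENNReal.add_lt_top.2 ⟨hφ, hψ⟩).ne
        (weightedSup_add_le c w φ.1 ψ.1))
    (fun a φ => by
      have : ((a • φ : weightedSpace c w) : smoothFunctions d) = a • φ.1 := rfl
      rw [this, weightedSup_smul, ENNReal.toReal_mul, ENNReal.toReal_ofReal (norm_nonneg a)])

end

/-- The topology defined by one seminorm. -/
@[reducible]
def seminormTopology {E : Type*} [AddCommGroup E] [Module ℂ E] (p : Seminorm ℂ E) :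
    TopologicalSpace E :=
  p.toSeminormedAddCommGroup.toUniformSpace.toTopologicalSpace

/-- The coefficients `h^p / M_p`. -/
def stepCoeff (M : ℕ → ℝ) (h : ℝ) (p : ℕ) : ℝ := h ^ p / M p

/-- The coefficients `1 / (M_p r_0 r_1 ⋯ r_p)`. -/
def komatsuCoeff (M r : ℕ → ℝ) (p : ℕ) : ℝ := 1 / (M p * ∏ j ∈ Finset.range (p + 1), r j)

/-- The Beurling type Gelfand–Shilov space `S^{(M_p)}_{(A_p)}(ℝ^d)`: all smooth `φ` with
`sup_α sup_x h^{|α|} |∂^α φ(x)| exp (A(τ x)) / M_{|α|} < ∞` for all `h, τ > 0`. -/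
def beurlingSpace (d : ℕ) (M A : ℕ → ℝ) : Submodule ℂ (smoothFunctions d) :=
  ⨅ (h : Set.Ioi (0 : ℝ)) (τ : Set.Ioi (0 : ℝ)),
    weightedSpace (stepCoeff M h) (fun x => Real.exp (assocFun A ‖(τ : ℝ) • x‖))

section

variable {d : ℕ} (M : ℕ → ℝ) (v : ℕ → EuclideanSpace ℝ (Fin d) → ℝ)

/-! ### The (LB)-space -/

/-- The steps of the inductive limit: `φ ∈ C^∞(ℝ^d)` with
`sup_α sup_x n^{-|α|} |∂^α φ(x)| v_n(x) / M_{|α|} < ∞` (`n ≥ 1`, shifted to `n + 1`). -/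
abbrev roumieuStep (n : ℕ) : Submodule ℂ (smoothFunctions d) :=
  weightedSpace (stepCoeff M (1 / ((n : ℝ) + 1))) (v n)

/-- The space `B^{M_p}_V(ℝ^d)` as a set: the union of its steps, see `mem_roumieuSpace_iff`. -/
def roumieuSpace : Submodule ℂ (smoothFunctions d) :=
  ⨆ n, roumieuStep M v n

/-- The inclusion of a step into the whole space. -/
def roumieuIncl (n : ℕ) : roumieuStep M v n →ₗ[ℂ] roumieuSpace M v :=
  Submodule.inclusion (le_iSup (roumieuStep M v) n)

/-- The norm topology on a step. -/
@[reducible]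
def roumieuStepTopology (n : ℕ) : TopologicalSpace (roumieuStep M v n) :=
  seminormTopology (weightedSeminorm (stepCoeff M (1 / ((n : ℝ) + 1))) (v n))

/-- The locally convex inductive limit topology: the finest locally convex vector space topology
for which the inclusions of all steps are continuous. -/
@[reducible]
def roumieuTopology : TopologicalSpace (roumieuSpace M v) :=
  sInf {t | @IsTopologicalAddGroup _ t _ ∧ @ContinuousSMul ℂ _ _ _ t ∧
    @LocallyConvexSpace ℝ _ _ _ _ _ t ∧
    ∀ n, @Continuous _ _ (roumieuStepTopology M v n) t (roumieuIncl M v n)}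

/-! ### The projective description -/

/-- The smooth `φ` with
`sup_α sup_x |∂^α φ(x)| u(x) / (M_{|α|} r_0 ⋯ r_{|α|}) < ∞`
for all `r` in Komatsu's family and all `u` in the maximal Nachbin family of `v`. -/
def projectiveSpace : Submodule ℂ (smoothFunctions d) :=
  ⨅ i : komatsuFamily × nachbinFamily v, weightedSpace (komatsuCoeff M i.1.1) i.2.1

theorem projectiveSpace_le (i : komatsuFamily × nachbinFamily v) :
    projectiveSpace M v ≤ weightedSpace (komatsuCoeff M i.1.1) i.2.1 :=
  iInf_le (fun i : komatsuFamily × nachbinFamily v =>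
    weightedSpace (komatsuCoeff M i.1.1) i.2.1) i

/-- The seminorms defining the topology of `projectiveSpace`. -/
def projectiveSeminorm (i : komatsuFamily × nachbinFamily v) :
    Seminorm ℂ (projectiveSpace M v) :=
  (weightedSeminorm (komatsuCoeff M i.1.1) i.2.1).comp
    (Submodule.inclusion (projectiveSpace_le M v i))

/-- The topology generated by all the seminorms `projectiveSeminorm`. -/
@[reducible]
def projectiveTopology : TopologicalSpace (projectiveSpace M v) :=
  ⨅ i, seminormTopology (projectiveSeminorm M v i)

variable {M v}

theorem mem_roumieuSpace_iff (hM : IsWeightSequence M) (hv : IsDecreasingWeightSystem v)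
    (φ : smoothFunctions d) : φ ∈ roumieuSpace M v ↔ ∃ n, φ ∈ roumieuStep M v n := by
  refine Submodule.mem_iSup_of_directed _ (Monotone.directed_le (monotone_nat_of_le_succ ?_))
  intro n ψ hψ
  refine lt_of_le_of_lt (iSup₂_mono fun α x => ENNReal.ofReal_le_ofReal ?_) hψ
  have h1 := hv.2.2 n x
  have h2 := (hv.2.1 (n + 1) x).le
  have h3 := hM.1 (∑ i, α i)
  unfold stepCoeff
  push_cast
  gcongr
  linarith

end

end GelfandShilov

end

open GelfandShilov

namespace GelfandShilov

/-! ### Weight sequences and associated functions -/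

/-! The continuous inclusion of the inductive limit in the projective space is elementary: the
products `r_0 ⋯ r_p` outgrow every `(n+1)^p`, and every Nachbin weight is bounded by a multiple of
each `v_n` (`exists_projective_bound`). The reverse inclusion of sets is a diagonal argument: if `φ`
violates the estimate of every step, the violating orders and points determine one slowly growing
`r` and one weight `u` whose seminorm is infinite at `φ` (`projectiveSpace_le_roumieuSpace`).

The topologies are compared in phase space. Let `ψ ≠ 0` lie in the Beurling space. The short-time
Fourier transform with window `conj ψ` turns derivative bounds on `φ` into moment bounds `|V(x,ξ)|
w(x) |ξ|^p ≤ C κ^p M_p a_p` (`exists_stft_bound`). Conversely, any measurable `G` on phase space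
with such bounds synthesises to an element of some step with a norm estimate (`exists_synthesis`),
and synthesis of `V` gives back `φ` times `∫ |ψ|²` (`integral_stft_mul`). No smoothness of `G` is
needed, so `V` may be cut up by indicator functions.

Let `U` be a convex neighbourhood of zero for a topology making all inclusions of steps continuous;
it contains an `ε_n`-ball of each step. Condition `(V)`, extended to weights in both `x` and `|ξ|`
(`exists_phase_space_weights`), yields `r` and `u` such that, when the corresponding seminorm of `φ`
is at most 1, each point of phase space satisfies one of finitely many prescribed small estimates.
The number of estimates depends on `φ`, but `r` and `u` do not. Cutting `V` accordingly gives `φ = ∑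
2^{-k-1} f_k`, a finite sum with each `f_k` in one of these balls (`exists_decomposition`), and
convexity puts `φ` in `U`. -/

theorem IsWeightSequence.exists_dominant_index {M : ℕ → ℝ} (hM : IsWeightSequence M) (T : ℝ) :
    ∃ P : ℕ, ∀ t, 0 ≤ t → t ≤ T → ∀ p, ∃ q ≤ P, t ^ p / M p ≤ t ^ q / M q := by
  -- Once `M (p + 1) / M p ≥ T`, the terms `t ^ p / M p` with `t ≤ T` no longer increase in `p`.
  obtain ⟨P, hP⟩ := eventually_atTop.1 (hM.2.eventually_ge_atTop T)
  refine ⟨P, fun t ht htT p => ?_⟩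
  rcases le_total p P with h | h
  · exact ⟨p, h, le_rfl⟩
  · refine ⟨P, le_rfl, ?_⟩
    induction p, h using Nat.le_induction with
    | base => exact le_rfl
    | succ p hp ih =>
      refine le_trans ?_ ih
      have h1 := hP p hp
      have hp0 := hM.1 p
      have hp1 := hM.1 (p + 1)
      rw [le_div_iff₀ hp0] at h1
      rw [div_le_div_iff₀ hp1 hp0, pow_succ, mul_assoc]
      gcongr
      nlinarith

theorem IsWeightSequence.exists_bound {M : ℕ → ℝ} (hM : IsWeightSequence M) (T : ℝ) :
    ∃ K : ℝ, 0 < K ∧ ∀ t, 0 ≤ t → t ≤ T → ∀ p, t ^ p / M p ≤ K := by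
  obtain ⟨P, hP⟩ := hM.exists_dominant_index T
  refine ⟨∑ q ∈ Finset.range (P + 1), |T| ^ q / M q + 1, ?_, fun t ht htT p => ?_⟩
  · have : 0 ≤ ∑ q ∈ Finset.range (P + 1), |T| ^ q / M q :=
      Finset.sum_nonneg fun q _ => div_nonneg (by positivity) (hM.1 q).le
    linarith
  · obtain ⟨q, hq, h⟩ := hP t ht htT p
    have h1 : t ^ q / M q ≤ |T| ^ q / M q := by
      have := hM.1 q
      gcongr
      exact htT.trans (le_abs_self T)
    have h2 : |T| ^ q / M q ≤ ∑ q ∈ Finset.range (P + 1), |T| ^ q / M q :=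
      Finset.single_le_sum (f := fun q => |T| ^ q / M q)
        (fun q _ => div_nonneg (by positivity) (hM.1 q).le) (Finset.mem_range.2 (by omega))
    linarith

/-- Doubling the argument absorbs any constant once the argument is large. If `2 ^ p ≥ |Λ|` the same
exponent works; for the finitely many smaller `p`, passing to a fixed exponent `m > p` gains at
least one factor `t`. -/
theorem exists_gain {M : ℕ → ℝ} (hM : ∀ p, 0 < M p) (Λ : ℝ) :
    ∃ T : ℝ, 1 ≤ T ∧ ∀ t, T ≤ t → ∀ p, ∃ q, Λ * (t ^ p / M p) ≤ (2 * t) ^ q / M q := by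
  obtain ⟨m, hm⟩ := pow_unbounded_of_one_lt |Λ| (one_lt_two (α := ℝ))
  have hs : 0 ≤ ∑ p ∈ Finset.range m, |Λ| * M m / M p :=
    Finset.sum_nonneg fun q _ => div_nonneg (mul_nonneg (abs_nonneg _) (hM m).le) (hM q).le
  refine ⟨∑ p ∈ Finset.range m, |Λ| * M m / M p + 1, by linarith, fun t ht p => ?_⟩
  have ht1 : 1 ≤ t := by linarith
  rcases le_or_gt m p with h | h
  · refine ⟨p, ?_⟩
    have h1 : Λ ≤ 2 ^ p := (le_abs_self Λ).trans (hm.le.trans (pow_le_pow_right₀ one_le_two h))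
    have h2 : 0 ≤ t ^ p / M p := div_nonneg (by positivity) (hM p).le
    calc Λ * (t ^ p / M p) ≤ 2 ^ p * (t ^ p / M p) := by gcongr
      _ = _ := by rw [mul_pow]; ring
  · refine ⟨m, ?_⟩
    have h1 : |Λ| * M m / M p ≤ ∑ p ∈ Finset.range m, |Λ| * M m / M p :=
      Finset.single_le_sum (f := fun p => |Λ| * M m / M p)
        (fun q _ => div_nonneg (mul_nonneg (abs_nonneg _) (hM m).le) (hM q).le)
        (Finset.mem_range.2 h)
    have h2 : |Λ| * M m / M p ≤ t := by linarith
    have hp0 := hM p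
    have hm0 := hM m
    calc Λ * (t ^ p / M p) ≤ |Λ| * (t ^ p / M p) := by
          gcongr; exact le_abs_self Λ
      _ = (|Λ| * M m / M p) * t ^ p / M m := by field_simp
      _ ≤ t * t ^ p / M m := by gcongr
      _ = t ^ (p + 1) / M m := by ring
      _ ≤ t ^ m / M m := by gcongr; omega
      _ ≤ (2 * t) ^ m / M m := by gcongr; linarith

theorem le_exp_assocFun {A : ℕ → ℝ} (hA : IsWeightSequence A) {t : ℝ} (ht : 0 ≤ t) (p : ℕ) :
    t ^ p * A 0 / A p ≤ Real.exp (assocFun A t) := by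
  rcases ht.eq_or_lt with rfl | ht
  · rcases p with _ | p
    · simp [assocFun, (hA.1 0).ne']
    · simp [Real.exp_nonneg]
  · have h0 := hA.1 0
    have hp := hA.1 p
    obtain ⟨K, hK, hb⟩ := hA.exists_bound t
    have hbdd : BddAbove (Set.range fun p : ℕ => Real.log (t ^ p * A 0 / A p)) := by
      refine ⟨Real.log (K * A 0), ?_⟩
      rintro _ ⟨q, rfl⟩
      have hq := hA.1 q
      refine Real.log_le_log (by positivity) ?_
      have := mul_le_mul_of_nonneg_right (hb t ht.le le_rfl q) h0.le
      rwa [div_mul_eq_mul_div] at this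
    rw [assocFun, if_pos ht, ← Real.log_le_iff_le_exp (by positivity)]
    exact le_ciSup hbdd p

theorem exp_assocFun_le {A : ℕ → ℝ} (hA : ∀ p, 0 < A p) {t B : ℝ}
    (h : ∀ p, t ^ p * A 0 / A p ≤ B) : Real.exp (assocFun A t) ≤ B := by
  have h1 : 1 ≤ B := by
    have := h 0
    rwa [pow_zero, one_mul, div_self (hA 0).ne'] at this
  unfold assocFun
  split_ifs with ht
  · rw [← Real.le_log_iff_exp_le (by linarith)]
    refine ciSup_le fun p => Real.log_le_log ?_ (h p)
    have := hA 0
    have := hA p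
    positivity
  · simpa using h1

theorem ConditionM2'.exists_shift_le {M : ℕ → ℝ} (h : ConditionM2' M) (m : ℕ) : ∃ C H : ℝ, 1 ≤ C ∧ 1 ≤ H ∧ ∀ p, M (p + m) ≤ C * H ^ p * M p := by
  obtain ⟨C₀, H₀, hC₀, hH₀, h⟩ := h
  induction m with
  | zero => exact ⟨1, 1, le_rfl, le_rfl, fun p => by simp⟩
  | succ m ih =>
    obtain ⟨C, H, hC, hH, ih⟩ := ih
    refine ⟨C₀ * H₀ ^ m * C, H₀ * H, ?_, one_le_mul_of_one_le_of_one_le hH₀ hH, fun p => ?_⟩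
    · exact one_le_mul_of_one_le_of_one_le
        (one_le_mul_of_one_le_of_one_le hC₀ (one_le_pow₀ hH₀)) hC
    · calc M (p + (m + 1)) ≤ C₀ * H₀ ^ (p + m) * M (p + m) := h (p + m)
        _ ≤ C₀ * H₀ ^ (p + m) * (C * H ^ p * M p) := by gcongr; exact ih p
        _ = _ := by rw [pow_add, mul_pow]; ring

/-- Log-convexity makes the ratios `M (p + 1) / M p` increase, so moving one index from the second
factor to the first along these ratios never helps. This recombines the two factors of the Leibniz
rule. -/
theorem ConditionM1.mul_le {M : ℕ → ℝ} (hM : ∀ p, 0 < M p) (h : ConditionM1 M) (j k : ℕ) :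
    M j * M k ≤ M 0 * M (j + k) := by
  have hmono : Monotone fun p => M (p + 1) / M p := monotone_nat_of_le_succ fun p => by
    rw [div_le_div_iff₀ (hM p) (hM (p + 1))]
    nlinarith [h p]
  induction j with
  | zero => simp
  | succ j ih =>
    have h1 := hmono (Nat.le_add_right j k)
    have hj := hM j
    have hjk := hM (j + k)
    have h0 := hM 0
    have hk := hM k
    have h2 : 0 ≤ M (j + 1) / M j := div_nonneg (hM _).le hj.le
    calc M (j + 1) * M k = M (j + 1) / M j * (M j * M k) := by field_simp
      _ ≤ M (j + 1) / M j * (M 0 * M (j + k)) := by gcongr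
      _ ≤ M (j + k + 1) / M (j + k) * (M 0 * M (j + k)) := by gcongr
      _ = M 0 * M (j + 1 + k) := by rw [add_right_comm]; field_simp

theorem one_add_pow_le (m : ℕ) {s : ℝ} (hs : 0 ≤ s) : (1 + s) ^ m ≤ 2 ^ m * (1 + s ^ m) := by
  rcases le_total s 1 with h | h
  · calc (1 + s) ^ m ≤ 2 ^ m := by gcongr; linarith
      _ ≤ _ := le_mul_of_one_le_right (by positivity) (by linarith [pow_nonneg hs m])
  · calc (1 + s) ^ m ≤ (2 * s) ^ m := by gcongr; linarith
      _ = 2 ^ m * s ^ m := mul_pow ..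
      _ ≤ _ := by gcongr; linarith

/-- The factor `s ^ m` only shifts the exponent, and `(M.2)'` pays for the shift of the denominator
by a dilation of the argument. This provides the integrable decay of windows. -/
theorem exists_one_add_pow_mul_exp_assocFun_le {A : ℕ → ℝ} (hA : IsWeightSequence A)
    (hA2 : ConditionM2' A) (m : ℕ) : ∃ C H : ℝ, 0 < C ∧ 0 < H ∧ ∀ s, 0 ≤ s →
      (1 + s) ^ m * Real.exp (assocFun A s) ≤ C * Real.exp (assocFun A (H * s)) := by
  obtain ⟨C, H, hC, hH, h⟩ := hA2.exists_shift_le m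
  refine ⟨2 ^ m * (1 + C), H, by positivity, by linarith, fun s hs => ?_⟩
  have h0 := hA.1 0
  rw [mul_comm, ← le_div_iff₀ (by positivity)]
  refine exp_assocFun_le hA.1 fun p => ?_
  rw [le_div_iff₀ (by positivity), mul_comm]
  have hp := hA.1 p
  have hpm := hA.1 (p + m)
  have e1 : s ^ p * A 0 / A p ≤ Real.exp (assocFun A (H * s)) := by
    refine le_trans ?_ (le_exp_assocFun hA (by positivity) p)
    gcongr
    exact le_mul_of_one_le_left hs hH
  have e2 : s ^ m * (s ^ p * A 0 / A p) ≤ C * Real.exp (assocFun A (H * s)) := by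
    calc s ^ m * (s ^ p * A 0 / A p) = s ^ (p + m) * A 0 / A p := by ring
      _ ≤ s ^ (p + m) * A 0 * (C * H ^ p / A (p + m)) := by
        rw [div_eq_mul_inv]
        gcongr
        rw [le_div_iff₀ hpm, inv_mul_le_iff₀ hp]
        linarith [h p]
      _ ≤ s ^ (p + m) * A 0 * (C * H ^ (p + m) / A (p + m)) := by
        gcongr
        omega
      _ = C * ((H * s) ^ (p + m) * A 0 / A (p + m)) := by rw [mul_pow]; ring
      _ ≤ _ := by gcongr; exact le_exp_assocFun hA (by positivity) _
  calc (1 + s) ^ m * (s ^ p * A 0 / A p) ≤ 2 ^ m * (1 + s ^ m) * (s ^ p * A 0 / A p) := by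
        gcongr; exact one_add_pow_le m hs
    _ = 2 ^ m * (s ^ p * A 0 / A p + s ^ m * (s ^ p * A 0 / A p)) := by ring
    _ ≤ 2 ^ m * (Real.exp (assocFun A (H * s)) + C * Real.exp (assocFun A (H * s))) := by
        gcongr
    _ = _ := by ring

/-! ### Slowly growing sequences -/

theorem exists_komatsu_le (P : ℕ → ℕ) : ∃ r ∈ komatsuFamily, (∀ j, 1 ≤ r j) ∧
    ∀ n j, j ≤ P n → r j ≤ (n : ℝ) + 1 := by
  -- The sequence is `r j = 1 + min {m | j ≤ m ∨ j ≤ P m}`. The alternative `j ≤ m` keeps the set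
  -- nonempty when `P` is bounded.
  have hmono : Monotone fun j => sInf {m | j ≤ m ∨ j ≤ P m} := by
    intro i j hij
    refine csInf_le_csInf ⟨0, fun _ _ => Nat.zero_le _⟩ ⟨j, Or.inl le_rfl⟩ ?_
    rintro m (h | h)
    · exact Or.inl (hij.trans h)
    · exact Or.inr (hij.trans h)
  refine ⟨fun j => ((sInf {m | j ≤ m ∨ j ≤ P m} : ℕ) : ℝ) + 1, ⟨fun j => by positivity, ?_, ?_⟩,
    fun j => by simp, fun n j hj => ?_⟩
  · intro i j hij
    have : ((sInf {m | i ≤ m ∨ i ≤ P m} : ℕ) : ℝ) ≤ (sInf {m | j ≤ m ∨ j ≤ P m} : ℕ) := by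
      exact_mod_cast hmono hij
    simpa using this
  · refine tendsto_atTop_add_const_right _ _ (tendsto_natCast_atTop_atTop.comp ?_)
    refine tendsto_atTop_atTop_of_monotone hmono fun b => ?_
    -- This index exceeds `b` and every `P m` with `m < b`, so no `m < b` belongs to the set.
    refine ⟨b + ∑ m ∈ Finset.range b, P m + 1, ?_⟩
    by_contra! hlt
    rcases Nat.sInf_mem (s := {m | b + ∑ m ∈ Finset.range b, P m + 1 ≤ m ∨
      b + ∑ m ∈ Finset.range b, P m + 1 ≤ P m}) ⟨_, Or.inl le_rfl⟩ with h | h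
    · have h' := h.trans hlt.le
      omega
    · have h1 := Finset.single_le_sum (f := P) (fun _ _ => Nat.zero_le _) (Finset.mem_range.2 hlt)
      have h' := h.trans h1
      omega
  · have : sInf {m | j ≤ m ∨ j ≤ P m} ≤ n := Nat.sInf_le (Or.inr hj)
    have : ((sInf {m | j ≤ m ∨ j ≤ P m} : ℕ) : ℝ) ≤ n := by exact_mod_cast this
    simpa using this

/-- The entry `r 0` is kept apart because it is later replaced by a small constant, independently of
the growth of the rest. -/
theorem prod_range_succ_le_pow {r : ℕ → ℝ} (hr : ∀ j, 0 < r j) {b : ℝ} {q : ℕ}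
    (h : ∀ j, 1 ≤ j → j ≤ q → r j ≤ b) :
    ∏ j ∈ Finset.range (q + 1), r j ≤ r 0 * b ^ q := by
  induction q with
  | zero => simp
  | succ q ih =>
    have hb : 0 ≤ b := (hr (q + 1)).le.trans (h (q + 1) (by omega) le_rfl)
    rw [Finset.prod_range_succ, pow_succ, ← mul_assoc]
    have := hr 0
    have := hr (q + 1)
    gcongr
    · exact ih fun j h1 h2 => h j h1 (by omega)
    · exact h (q + 1) (by omega) le_rfl

theorem monotone_prod_range_succ {r : ℕ → ℝ} (hr : ∀ j, 0 < r j) (h1 : ∀ j, 1 ≤ j → 1 ≤ r j) :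
    Monotone fun p => ∏ j ∈ Finset.range (p + 1), r j :=
  monotone_nat_of_le_succ fun p => by
    rw [Finset.prod_range_succ _ (p + 1)]
    exact le_mul_of_one_le_right (Finset.prod_nonneg fun j _ => (hr j).le) (h1 _ (by omega))

/-- For a prescribed sequence of factors `l`, the radial weights `ρ ↦ sup_p ρ ^ p / (M_p (k+1) ^ p)`
are dominated, one at each radius, by the weight of some sequence in Komatsu's family. -/
theorem exists_komatsu_dominating {M : ℕ → ℝ} (hM : IsWeightSequence M) (l : ℕ → ℝ)
    (hl : ∀ k, 0 < l k) {c C : ℝ} (hc : 0 < c) (hC : 0 < C) :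
    ∃ r ∈ komatsuFamily, (∀ j, 1 ≤ j → 1 ≤ r j) ∧ ∀ ρ₀ : ℝ, ∃ J : ℕ, ∀ ρ, 0 ≤ ρ → ρ ≤ ρ₀ →
      ∃ j ≤ J, ∀ p, ∃ q, l j * (ρ / (j + 1)) ^ p / M p * C * (c ^ q * (M q *
        ∏ i ∈ Finset.range (q + 1), r i)) ≤ ρ ^ q := by
  obtain ⟨L, hL⟩ := exists_nat_ge (2 * c)
  -- On the band `T s ≤ ρ < T (s + 1)` the weight of index `lev s` is used. Three losses, namely 2
  -- from the gain, `c`, and `s + 1` from the product of the `r i`, must be covered by `lev s + 1`.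
  set lev : ℕ → ℕ := fun s => L * (s + 1) with hlev
  have hlev1 : ∀ s : ℕ, 2 * c * (s + 1) ≤ (lev s : ℝ) + 1 := fun s => by
    have : (lev s : ℝ) = L * (s + 1) := by simp [hlev]
    rw [this]
    have : 2 * c * ((s : ℝ) + 1) ≤ L * (s + 1) := by gcongr
    linarith
  choose T₀ hT₀ hT using fun s => exists_gain hM.1 (l (lev s) * C)
  -- The first summand puts `ρ / (lev s + 1)` in the range where the gain applies; the summand `s`
  -- makes the bands exhaust the half-line.
  set T : ℕ → ℝ := fun s => T₀ s * (lev s + 1) + s with hTdef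
  -- On band `s` only exponents `q ≤ P s` matter, so it suffices that `r j ≤ s + 1` for `1 ≤ j ≤ P
  -- s`.
  choose P hP using fun s => hM.exists_dominant_index (2 * T (s + 1))
  obtain ⟨r, ⟨hr0, hrm, hrt⟩, hr1, hrP⟩ := exists_komatsu_le P
  obtain ⟨K, hK, hKb⟩ := hM.exists_bound (T 1)
  have hM0 := hM.1 0
  have hl0 := hl (lev 0)
  -- No gain is available on the lowest band. There `q = 0` is chosen, so that only the zeroth entry
  -- of the sequence occurs, and `δ` makes the left side at most 1.
  set δ : ℝ := min 1 (1 / (l (lev 0) * K * C * M 0)) with hδ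
  have hδ0 : 0 < δ := lt_min one_pos (by positivity)
  have hδ1 : δ ≤ 1 := min_le_left _ _
  set r' : ℕ → ℝ := fun j => if j = 0 then δ else r j with hr'
  have hr'0 : ∀ j, 0 < r' j := fun j => by
    simp only [hr']; split_ifs; exacts [hδ0, hr0 j]
  have hr'pos : ∀ j, 1 ≤ j → r' j = r j := fun j hj => by
    simp only [hr']; rw [if_neg (by omega)]
  refine ⟨r', ⟨hr'0, ?_, ?_⟩, fun j hj => by rw [hr'pos j hj]; exact hr1 j, fun ρ₀ => ?_⟩
  · refine monotone_nat_of_le_succ fun j => ?_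
    rw [hr'pos (j + 1) (by omega)]
    rcases j with _ | j
    · simpa [hr'] using hδ1.trans (hr1 1)
    · rw [hr'pos (j + 1) (by omega)]
      exact hrm (Nat.le_succ _)
  · refine hrt.congr' ?_
    filter_upwards [eventually_ge_atTop 1] with j hj
    exact (hr'pos j hj).symm
  · obtain ⟨S, hS⟩ := exists_nat_ge ρ₀
    refine ⟨L * (S + 1), fun ρ hρ hρ₀ => ?_⟩
    have hTs : ∀ s : ℕ, (s : ℝ) ≤ T s := fun s => by
      have := hT₀ s
      have : 0 ≤ T₀ s * ((lev s : ℝ) + 1) := by positivity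
      simp only [hTdef]; linarith
    have hex : ∃ s, ρ < T (s + 1) := ⟨S, by
      have := hTs (S + 1)
      push_cast at this
      linarith⟩
    classical
    set s := Nat.find hex with hs
    have hsS : s ≤ S := Nat.find_min' hex (by
      have := hTs (S + 1)
      push_cast at this
      linarith)
    have hsT : ρ < T (s + 1) := Nat.find_spec hex
    refine ⟨lev s, Nat.mul_le_mul_left _ (by omega), fun p => ?_⟩
    have hlevpos : (0 : ℝ) < (lev s : ℝ) + 1 := by positivity
    rcases Nat.eq_zero_or_pos s with h0 | hpos
    · refine ⟨0, ?_⟩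
      rw [h0] at hsT ⊢
      have h1 : (ρ / ((lev 0 : ℝ) + 1)) ^ p / M p ≤ K := by
        refine hKb _ (by positivity) ?_ p
        refine (div_le_self hρ ?_).trans hsT.le
        have : (0 : ℝ) ≤ lev 0 := by positivity
        linarith
      have h2 : δ ≤ 1 / (l (lev 0) * K * C * M 0) := min_le_right _ _
      have h3 : 0 ≤ (ρ / ((lev 0 : ℝ) + 1)) ^ p / M p := div_nonneg (by positivity) (hM.1 p).le
      calc l (lev 0) * (ρ / ((lev 0 : ℕ) + 1)) ^ p / M p * C * (c ^ 0 * (M 0 *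
            ∏ i ∈ Finset.range (0 + 1), r' i))
          = l (lev 0) * ((ρ / ((lev 0 : ℝ) + 1)) ^ p / M p) * C * M 0 * δ := by
            simp [hr']; ring
        _ ≤ l (lev 0) * K * C * M 0 * (1 / (l (lev 0) * K * C * M 0)) := by gcongr
        _ = 1 := by field_simp
        _ = ρ ^ 0 := (pow_zero ρ).symm
    · have hTle : T s ≤ ρ := by
        have := Nat.find_min hex (m := s - 1) (by omega)
        rw [Nat.sub_add_cancel hpos] at this
        exact not_lt.1 this
      have ht : T₀ s ≤ ρ / ((lev s : ℝ) + 1) := by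
        rw [le_div_iff₀ hlevpos]
        have : (0 : ℝ) ≤ s := by positivity
        simp only [hTdef] at hTle
        linarith
      obtain ⟨q₀, hq₀⟩ := hT s _ ht p
      have hle : 2 * (ρ / ((lev s : ℝ) + 1)) ≤ 2 * T (s + 1) := by
        have : ρ / ((lev s : ℝ) + 1) ≤ ρ := div_le_self hρ (by
          have : (0 : ℝ) ≤ lev s := by positivity
          linarith)
        linarith
      obtain ⟨q, hq, hqq⟩ := hP s _ (by positivity) hle q₀
      refine ⟨q, ?_⟩
      have hMq := hM.1 q
      have hprod : ∏ i ∈ Finset.range (q + 1), r' i ≤ ((s : ℝ) + 1) ^ q := by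
        refine (prod_range_succ_le_pow hr'0 (b := (s : ℝ) + 1) fun j h1 h2 => ?_).trans ?_
        · rw [hr'pos j h1]
          exact hrP s j (h2.trans hq)
        · have : r' 0 = δ := by simp [hr']
          rw [this]
          exact mul_le_of_le_one_left (by positivity) hδ1
      have hprod0 : 0 ≤ ∏ i ∈ Finset.range (q + 1), r' i :=
        Finset.prod_nonneg fun j _ => (hr'0 j).le
      calc l (lev s) * (ρ / ((lev s : ℝ) + 1)) ^ p / M p * C *
            (c ^ q * (M q * ∏ i ∈ Finset.range (q + 1), r' i))
          = l (lev s) * C * ((ρ / ((lev s : ℝ) + 1)) ^ p / M p) *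
            (c ^ q * (M q * ∏ i ∈ Finset.range (q + 1), r' i)) := by ring
        _ ≤ (2 * (ρ / ((lev s : ℝ) + 1))) ^ q / M q * (c ^ q * (M q * ((s : ℝ) + 1) ^ q)) := by
            gcongr
            exact hq₀.trans hqq
        _ = (2 * c * (s + 1) / ((lev s : ℝ) + 1)) ^ q * ρ ^ q := by
            simp only [div_pow, mul_pow]; field_simp
        _ ≤ 1 ^ q * ρ ^ q := by
            gcongr
            exact (div_le_one hlevpos).2 (hlev1 s)
        _ = ρ ^ q := by simp

/-- Condition `(V)` for the weights `v_k(x) sup_p ρ ^ p / (M_p (k+1) ^ p)` in phase space. -/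
theorem exists_phase_space_weights {X : Type*} [TopologicalSpace X] {M : ℕ → ℝ}
    (hM : IsWeightSequence M) {v : ℕ → X → ℝ} (hv : IsDecreasingWeightSystem v)
    (hV : ConditionV v) (l : ℕ → ℝ) {c C : ℝ} (hc : 0 < c) (hC : 0 < C) :
    ∃ u ∈ nachbinFamily v, ∃ r ∈ komatsuFamily, (∀ j, 1 ≤ j → 1 ≤ r j) ∧
      ∀ (n : ℕ) (B : ℝ), ∃ N : ℕ, ∀ (x : X) (ρ y : ℝ), 0 ≤ ρ → 0 ≤ y →
        (∀ p, y * v n x * ρ ^ p ≤ B * ((n : ℝ) + 1) ^ p * M p) →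
        (∀ p, y * u x * ρ ^ p ≤ C * (c ^ p * (M p * ∏ j ∈ Finset.range (p + 1), r j))) →
        ∃ k ≤ N, ∀ p, l k * (y * v k x * ρ ^ p) ≤ ((k : ℝ) + 1) ^ p * M p := by
  -- Each `lam k` is at least 1 and dominates `l k`, so `l (max k j) ≤ lam k * lam j`: the same
  -- factors can be requested separately in `x` and in `ρ`.
  set lam : ℕ → ℝ := fun k => 1 + ∑ i ∈ Finset.range (k + 1), |l i| with hlam
  have hlam1 : ∀ k, 1 ≤ lam k := fun k => by
    have : 0 ≤ ∑ i ∈ Finset.range (k + 1), |l i| := Finset.sum_nonneg fun _ _ => abs_nonneg _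
    simp only [hlam]; linarith
  have hlam0 : ∀ k, 0 < lam k := fun k => one_pos.trans_le (hlam1 k)
  have hlaml : ∀ k, l k ≤ lam k := fun k => by
    have : |l k| ≤ ∑ i ∈ Finset.range (k + 1), |l i| :=
      Finset.single_le_sum (f := fun i => |l i|) (fun _ _ => abs_nonneg _) (by simp)
    simp only [hlam]; linarith [le_abs_self (l k)]
  have hvanti : ∀ x, Antitone fun k => v k x := fun x => antitone_nat_of_succ_le fun k => hv.2.2 k x
  obtain ⟨u, hu, hVu⟩ := hV lam hlam0
  obtain ⟨r, hr, hr1, hrJ⟩ := exists_komatsu_dominating hM lam hlam0 hc hC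
  refine ⟨u, hu, r, hr, hr1, fun n B => ?_⟩
  -- combination of a bound in `x` and a bound in `ρ`
  have key : ∀ (x : X) (ρ y : ℝ), 0 ≤ ρ → 0 ≤ y → ∀ k j : ℕ,
      (∀ p, (lam k * v k x) * (lam j * (ρ / ((j : ℝ) + 1)) ^ p / M p) * y ≤ 1) →
      ∀ p, l (max k j) * (y * v (max k j) x * ρ ^ p) ≤ (((max k j : ℕ) : ℝ) + 1) ^ p * M p := by
    intro x ρ y hρ hy k j h p
    have hMp := hM.1 p
    have h1 : l (max k j) ≤ lam k * lam j := by
      refine (hlaml _).trans ?_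
      rcases le_total k j with hkj | hkj
      · rw [max_eq_right hkj]
        exact le_mul_of_one_le_left (hlam0 j).le (hlam1 k)
      · rw [max_eq_left hkj]
        exact le_mul_of_one_le_right (hlam0 k).le (hlam1 j)
    have h2 : v (max k j) x ≤ v k x := hvanti x (le_max_left k j)
    have h3 := (hv.2.1 (max k j) x).le
    have h4 : (j : ℝ) ≤ (max k j : ℕ) := by exact_mod_cast le_max_right k j
    have hvk := hv.2.1 k x
    have hlk := hlam0 k
    have hlj := hlam0 j
    calc l (max k j) * (y * v (max k j) x * ρ ^ p)
        ≤ lam k * lam j * (y * v k x * ρ ^ p) := by gcongr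
      _ = (lam k * v k x) * (lam j * (ρ / ((j : ℝ) + 1)) ^ p / M p) * y *
            (((j : ℝ) + 1) ^ p * M p) := by
          rw [div_pow]; field_simp
      _ ≤ 1 * (((j : ℝ) + 1) ^ p * M p) := by
          gcongr
          exact h p
      _ ≤ _ := by rw [one_mul]; gcongr
  have hM0 := hM.1 0
  obtain ⟨Ku, hKu⟩ := hu.2.2 n
  have hub : ∀ x, u x ≤ |Ku| * v n x := fun x => by
    have h1 : u x / v n x ≤ |Ku| := (hKu ⟨x, rfl⟩).trans (le_abs_self _)
    rwa [div_le_iff₀ (hv.2.1 n x)] at h1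
  set D : ℝ := |B| * (1 + |Ku|) + 1 with hD
  have hD0 : 0 < D := by positivity
  have hDB : |B| ≤ D := by
    have : 0 ≤ |B| * |Ku| := by positivity
    rw [hD]; linarith
  have hDKB : |Ku| * |B| ≤ D := by
    have : 0 ≤ |B| := by positivity
    rw [hD]; linarith
  -- Here `2 / (j₁ + 1) = 1 / (n + 1)`: the doubling in `exists_gain` turns the radial weight of
  -- index `j₁` into that of index `n`, where a bound by `B` is known.
  set j₁ : ℕ := 2 * n + 1 with hj₁
  obtain ⟨T, hT1, hT⟩ := exists_gain hM.1 (lam j₁ * D)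
  set ρ₀ : ℝ := T * ((j₁ : ℝ) + 1) with hρ₀
  obtain ⟨J, hJ⟩ := hrJ ρ₀
  obtain ⟨K, hK, hKb⟩ := hM.exists_bound ρ₀
  -- The factor `1 / (n₁ + 1)` in `(V)` has to beat the bound available for small radii.
  obtain ⟨n₁, hn₁⟩ := exists_nat_ge (max (n : ℝ) (|B| * M 0 * (lam 0 * K)))
  have hn₁n : n ≤ n₁ := by exact_mod_cast (le_max_left _ _).trans hn₁
  obtain ⟨N, hN⟩ := hVu n₁
  refine ⟨max N (max J j₁), fun x ρ y hρ hy h1 h2 => ?_⟩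
  have hvn := hv.2.1 n x
  have hvn₁ : v n₁ x ≤ v n x := hvanti x hn₁n
  have hvn₁0 := (hv.2.1 n₁ x).le
  have hB : ∀ p, y * v n x * ρ ^ p ≤ |B| * ((n : ℝ) + 1) ^ p * M p := fun p =>
    (h1 p).trans (by
      have := hM.1 p
      gcongr
      exact le_abs_self B)
  have hu0 := hu.1 x
  obtain ⟨k, hkN, hk⟩ : ∃ k ≤ N, lam k * v k x ≤ max (v n₁ x / ((n₁ : ℝ) + 1)) (u x) := by
    have := hN x
    rw [Finset.inf'_le_iff] at this
    obtain ⟨k, hk, h⟩ := this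
    exact ⟨k, by simpa [Nat.lt_succ_iff] using hk, h⟩
  have hgain : ρ₀ ≤ ρ → ∀ p, ∃ q, lam j₁ * (ρ / ((j₁ : ℝ) + 1)) ^ p / M p * D ≤
      (ρ / ((n : ℝ) + 1)) ^ q / M q := by
    intro h p
    have ht : T ≤ ρ / ((j₁ : ℝ) + 1) := by rwa [le_div_iff₀ (by positivity)]
    obtain ⟨q, hq⟩ := hT _ ht p
    refine ⟨q, ?_⟩
    have e : 2 * (ρ / ((j₁ : ℝ) + 1)) = ρ / ((n : ℝ) + 1) := by
      rw [hj₁]; push_cast; field_simp; ring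
    rw [e] at hq
    calc lam j₁ * (ρ / ((j₁ : ℝ) + 1)) ^ p / M p * D
        = lam j₁ * D * ((ρ / ((j₁ : ℝ) + 1)) ^ p / M p) := by ring
      _ ≤ _ := hq
  have hfinish : ∀ w : ℝ, 0 ≤ w → lam k * v k x ≤ w → ∀ j, j ≤ max J j₁ →
      (∀ p, w * (lam j * (ρ / ((j : ℝ) + 1)) ^ p / M p) * y ≤ 1) →
      ∃ k ≤ max N (max J j₁), ∀ p, l k * (y * v k x * ρ ^ p) ≤ ((k : ℝ) + 1) ^ p * M p := by
    intro w hw hkw j hj h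
    refine ⟨max k j, max_le_max hkN hj, key x ρ y hρ hy k j fun p => le_trans ?_ (h p)⟩
    have := hlam0 j
    have := hM.1 p
    gcongr
  have hBq : ∀ q, y * v n x * ((ρ / ((n : ℝ) + 1)) ^ q / M q) ≤ |B| := fun q => by
    have := hM.1 q
    rw [div_pow, div_div, ← mul_div_assoc, div_le_iff₀ (by positivity)]
    linarith [hB q]
  -- For `ρ ≥ ρ₀` the radial gain suffices in both cases, since `v n₁` and `u` are controlled by `v
  -- n`. For `ρ ≤ ρ₀`, the first case uses the smallness of `1 / (n₁ + 1)` with `j = 0`, and the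
  -- second uses `r` together with the bound involving `u`.
  rcases le_max_iff.1 hk with hk1 | hk1
  · rcases le_total ρ₀ ρ with hρρ | hρρ
    · refine hfinish _ (by positivity) hk1 j₁ (le_max_right _ _) fun p => ?_
      obtain ⟨q, hq⟩ := hgain hρρ p
      rw [← le_div_iff₀ hD0] at hq
      calc v n₁ x / ((n₁ : ℝ) + 1) * (lam j₁ * (ρ / ((j₁ : ℝ) + 1)) ^ p / M p) * y
          ≤ v n₁ x * ((ρ / ((n : ℝ) + 1)) ^ q / M q / D) * y := by
            have := hM.1 q
            have := hM.1 p
            have := hlam0 j₁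
            have : 0 ≤ lam j₁ * (ρ / ((j₁ : ℝ) + 1)) ^ p / M p := by positivity
            gcongr
            refine div_le_self hvn₁0 ?_
            have : (0 : ℝ) ≤ n₁ := by positivity
            linarith
        _ ≤ v n x * ((ρ / ((n : ℝ) + 1)) ^ q / M q / D) * y := by
            have := hM.1 q
            gcongr
        _ = y * v n x * ((ρ / ((n : ℝ) + 1)) ^ q / M q) / D := by ring
        _ ≤ |B| / D := by gcongr; exact hBq q
        _ ≤ 1 := (div_le_one hD0).2 hDB
    · refine hfinish _ (by positivity) hk1 0 (Nat.zero_le _) fun p => ?_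
      have hlamb := hlam0 0
      have hb : lam 0 * (ρ / (((0 : ℕ) : ℝ) + 1)) ^ p / M p ≤ lam 0 * K := by
        rw [mul_div_assoc]
        gcongr
        simpa using hKb ρ hρ hρρ p
      have hn₁' : |B| * M 0 * (lam 0 * K) ≤ n₁ := (le_max_right _ _).trans hn₁
      have hB0 : y * v n x ≤ |B| * M 0 := by simpa using hB 0
      calc v n₁ x / ((n₁ : ℝ) + 1) * (lam 0 * (ρ / (((0 : ℕ) : ℝ) + 1)) ^ p / M p) * y
          ≤ v n x / ((n₁ : ℝ) + 1) * (lam 0 * K) * y := by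
            have := hM.1 p
            have : 0 ≤ lam 0 * (ρ / (((0 : ℕ) : ℝ) + 1)) ^ p / M p := by positivity
            gcongr
        _ = y * v n x * (lam 0 * K) / ((n₁ : ℝ) + 1) := by ring
        _ ≤ |B| * M 0 * (lam 0 * K) / ((n₁ : ℝ) + 1) := by gcongr
        _ ≤ 1 := by rw [div_le_one (by positivity)]; linarith
  · rcases le_total ρ₀ ρ with hρρ | hρρ
    · refine hfinish _ hu0 hk1 j₁ (le_max_right _ _) fun p => ?_
      obtain ⟨q, hq⟩ := hgain hρρ p
      rw [← le_div_iff₀ hD0] at hq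
      have := hM.1 q
      calc u x * (lam j₁ * (ρ / ((j₁ : ℝ) + 1)) ^ p / M p) * y
          ≤ |Ku| * v n x * ((ρ / ((n : ℝ) + 1)) ^ q / M q / D) * y := by
            have := hM.1 p
            have := hlam0 j₁
            gcongr
            exact hub x
        _ = |Ku| * (y * v n x * ((ρ / ((n : ℝ) + 1)) ^ q / M q)) / D := by ring
        _ ≤ |Ku| * |B| / D := by gcongr; exact hBq q
        _ ≤ 1 := (div_le_one hD0).2 hDKB
    · obtain ⟨j, hjJ, hj⟩ := hJ ρ hρ hρρ
      refine hfinish _ hu0 hk1 j (hjJ.trans (le_max_left _ _)) fun p => ?_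
      obtain ⟨q, hq⟩ := hj p
      set R := c ^ q * (M q * ∏ i ∈ Finset.range (q + 1), r i) with hR
      have hR0 : 0 < R := by
        have := hM.1 q
        have : 0 < ∏ i ∈ Finset.range (q + 1), r i := Finset.prod_pos fun i _ => hr.1 i
        positivity
      have hq' : lam j * (ρ / ((j : ℝ) + 1)) ^ p / M p ≤ ρ ^ q / (C * R) := by
        rw [le_div_iff₀ (by positivity)]
        linarith
      calc u x * (lam j * (ρ / ((j : ℝ) + 1)) ^ p / M p) * y
          ≤ u x * (ρ ^ q / (C * R)) * y := by gcongr
        _ = y * u x * ρ ^ q / (C * R) := by ring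
        _ ≤ 1 := (div_le_one (by positivity)).2 (h2 q)

/-! ### Calculus of partial derivatives -/

theorem multiIndex_induction {d : ℕ} {P : (Fin d → ℕ) → Prop} (h0 : P 0)
    (hs : ∀ α i, P α → P (α + Pi.single i 1)) (α : Fin d → ℕ) : P α := by
  generalize hn : ∑ i, α i = n
  induction n generalizing α with
  | zero =>
    have : α = 0 := by
      ext i
      exact (Finset.sum_eq_zero_iff.1 hn) i (Finset.mem_univ i)
    rwa [this]
  | succ n ih =>
    obtain ⟨i, hi⟩ : ∃ i, α i ≠ 0 := by
      by_contra! h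
      simp [h] at hn
    have hα : α = (α - Pi.single i 1) + Pi.single i 1 := by
      ext j
      rcases eq_or_ne j i with rfl | hj
      · simp; omega
      · simp [hj]
    rw [hα]
    refine hs _ _ (ih _ ?_)
    rw [hα] at hn
    simp only [Pi.add_apply, Finset.sum_add_distrib, Finset.sum_pi_single',
      Finset.mem_univ, if_true] at hn
    omega

theorem sum_add_single {d : ℕ} (α : Fin d → ℕ) (i : Fin d) :
    ∑ j, (α + Pi.single i 1 : Fin d → ℕ) j = ∑ j, α j + 1 := by
  simp [Finset.sum_add_distrib]

theorem prod_map_pow_add_of_commute {ι R : Type*} [Monoid R] (f : ι → R)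
    (hf : ∀ i j, Commute (f i) (f j)) (α β : ι → ℕ) (l : List ι) :
    (l.map fun i => f i ^ (α i + β i)).prod =
      (l.map fun i => f i ^ α i).prod * (l.map fun i => f i ^ β i).prod := by
  induction l with
  | nil => simp
  | cons i l ih =>
    have h : Commute (f i ^ β i) (l.map fun i => f i ^ α i).prod := by
      refine Commute.list_prod_right _ _ fun x hx => ?_
      obtain ⟨j, -, rfl⟩ := List.mem_map.1 hx
      exact (hf i j).pow_pow _ _
    rw [List.map_cons, List.map_cons, List.map_cons, List.prod_cons, List.prod_cons,
      List.prod_cons, ih, pow_add, mul_assoc, ← mul_assoc (f i ^ β i), h.eq]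
    simp only [mul_assoc]

theorem prod_map_pow_single {ι R : Type*} [DecidableEq ι] [Monoid R] (f : ι → R) (i : ι) (n : ℕ)
    (l : List ι) (hl : l.Nodup) :
    (l.map fun j => f j ^ (Pi.single i n : ι → ℕ) j).prod = if i ∈ l then f i ^ n else 1 := by
  induction l with
  | nil => simp
  | cons j l ih =>
    rw [List.nodup_cons] at hl
    rw [List.map_cons, List.prod_cons, ih hl.2]
    rcases eq_or_ne j i with rfl | hj
    · simp [hl.1]
    · simp [hj, hj.symm]

section

variable {d : ℕ}

theorem partialD_apply (i : Fin d) (φ : smoothFunctions d) (x : EuclideanSpace ℝ (Fin d)) :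
    (partialD i φ).1 x = fderiv ℝ φ.1 x (EuclideanSpace.single i 1) := rfl

theorem commute_partialD (i j : Fin d) : Commute (partialD i) (partialD j) := by
  refine LinearMap.ext fun φ => Subtype.ext (funext fun x => ?_)
  have key : ∀ a b : Fin d, (partialD a (partialD b φ)).1 x =
      fderiv ℝ (fderiv ℝ φ.1) x (EuclideanSpace.single a 1) (EuclideanSpace.single b 1) := by
    intro a b
    have h : DifferentiableAt ℝ (fderiv ℝ φ.1) x :=
      (((smoothFunctions_contDiff φ).fderiv_right (m := ∞) (by simp)).differentiable
        (by simp)) x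
    have := fderiv_clm_apply h (differentiableAt_const (EuclideanSpace.single b (1 : ℝ)))
    rw [partialD_apply]
    change fderiv ℝ (fun y => fderiv ℝ φ.1 y (EuclideanSpace.single b 1)) x _ = _
    rw [this]
    simp
  have hsymm : IsSymmSndFDerivAt ℝ φ.1 x :=
    ((smoothFunctions_contDiff φ).contDiffAt).isSymmSndFDerivAt
      (by rw [minSmoothness_of_isRCLikeNormedField]; exact WithTop.coe_le_coe.2 (le_top : (2 : ℕ∞) ≤ ⊤))
  change (partialD i (partialD j φ)).1 x = (partialD j (partialD i φ)).1 x
  rw [key, key]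
  exact hsymm _ _

theorem multiD_add (α β : Fin d → ℕ) : multiD (α + β) = multiD α * multiD β :=
  prod_map_pow_add_of_commute partialD commute_partialD α β _

theorem multiD_single (i : Fin d) (n : ℕ) : multiD (Pi.single i n) = partialD i ^ n := by
  unfold multiD
  rw [prod_map_pow_single partialD i n _ (List.nodup_finRange d)]
  simp

theorem multiD_zero : multiD (0 : Fin d → ℕ) = 1 := by
  unfold multiD
  simp

theorem multiD_add_single_apply (α : Fin d → ℕ) (i : Fin d) (φ : smoothFunctions d) :
    multiD (α + Pi.single i 1) φ = multiD α (partialD i φ) := by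
  rw [multiD_add, multiD_single, pow_one]
  rfl

theorem partialD_multiD (α : Fin d → ℕ) (i : Fin d) (φ : smoothFunctions d) :
    partialD i (multiD α φ) = multiD (α + Pi.single i 1) φ := by
  rw [add_comm, multiD_add, multiD_single, pow_one]
  rfl

/-- The product of two smooth functions. -/
def smoothMul (f g : smoothFunctions d) : smoothFunctions d :=
  ⟨fun x => f.1 x * g.1 x, (smoothFunctions_contDiff f).mul (smoothFunctions_contDiff g)⟩

theorem partialD_smoothMul (i : Fin d) (f g : smoothFunctions d) :
    partialD i (smoothMul f g) = smoothMul (partialD i f) g + smoothMul f (partialD i g) := by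
  refine Subtype.ext (funext fun x => ?_)
  have := fderiv_mul (smoothFunctions_differentiable f x) (smoothFunctions_differentiable g x)
  change fderiv ℝ (f.1 * g.1) x (EuclideanSpace.single i 1) =
    fderiv ℝ f.1 x (EuclideanSpace.single i 1) * g.1 x +
      f.1 x * fderiv ℝ g.1 x (EuclideanSpace.single i 1)
  rw [this]
  simp
  ring

/-- If the bounds on the factors depend only on the order, the Leibniz sum over multi-indices
collapses to a binomial sum in `|α|`. The induction shifts `a` or `b` by one and recombines by
Pascal's rule, hence the quantification over all functions and bounds. -/
theorem norm_multiD_smoothMul_le (t : EuclideanSpace ℝ (Fin d)) (α : Fin d → ℕ) :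
    ∀ (f g : smoothFunctions d) (a b : ℕ → ℝ),
      (∀ β, ‖(multiD β f).1 t‖ ≤ a (∑ i, β i)) → (∀ β, ‖(multiD β g).1 t‖ ≤ b (∑ i, β i)) →
      ‖(multiD α (smoothMul f g)).1 t‖ ≤ ∑ ij ∈ Finset.HasAntidiagonal.antidiagonal (∑ i, α i),
        ((∑ i, α i).choose ij.1 : ℝ) * (a ij.1 * b ij.2) := by
  induction α using multiIndex_induction with
  | h0 =>
    intro f g a b ha hb
    have h1 := ha 0
    have h2 := hb 0
    simp only [multiD_zero, Module.End.one_apply, Pi.zero_apply, Finset.sum_const_zero] at h1 h2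
    simp only [multiD_zero, Module.End.one_apply, Pi.zero_apply, Finset.sum_const_zero,
      Finset.Nat.antidiagonal_zero, Finset.sum_singleton, Nat.choose_self, Nat.cast_one, one_mul]
    change ‖f.1 t * g.1 t‖ ≤ _
    rw [norm_mul]
    exact mul_le_mul h1 h2 (norm_nonneg _) ((norm_nonneg _).trans h1)
  | hs α i ih =>
    intro f g a b ha hb
    have ha' : ∀ β, ‖(multiD β (partialD i f)).1 t‖ ≤ a (∑ i, β i + 1) := fun β => by
      rw [← multiD_add_single_apply, ← sum_add_single β i]
      exact ha _
    have hb' : ∀ β, ‖(multiD β (partialD i g)).1 t‖ ≤ b (∑ i, β i + 1) := fun β => by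
      rw [← multiD_add_single_apply, ← sum_add_single β i]
      exact hb _
    have h1 := ih (partialD i f) g (fun p => a (p + 1)) b ha' hb
    have h2 := ih f (partialD i g) a (fun p => b (p + 1)) ha hb'
    rw [multiD_add_single_apply, partialD_smoothMul, map_add, sum_add_single,
      Finset.sum_antidiagonal_choose_succ_mul (fun p q => a p * b q)]
    refine (norm_add_le _ _).trans ?_
    rw [add_comm]
    refine add_le_add h2 (h1.trans_eq ?_)
    refine Finset.sum_congr rfl fun ij hij => ?_
    rw [← Finset.HasAntidiagonal.mem_antidiagonal.1 hij, Nat.choose_symm_add]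

/-- The translate `t ↦ f (t - x)`. -/
def smoothTranslate (x : EuclideanSpace ℝ (Fin d)) (f : smoothFunctions d) : smoothFunctions d :=
  ⟨fun t => f.1 (t - x), (smoothFunctions_contDiff f).comp (contDiff_id.sub contDiff_const)⟩

theorem partialD_smoothTranslate (i : Fin d) (x : EuclideanSpace ℝ (Fin d))
    (f : smoothFunctions d) :
    partialD i (smoothTranslate x f) = smoothTranslate x (partialD i f) := by
  refine Subtype.ext (funext fun t => ?_)
  change fderiv ℝ (fun t => f.1 (t - x)) t _ = fderiv ℝ f.1 (t - x) _
  rw [fderiv_comp_sub]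

theorem multiD_smoothTranslate (α : Fin d → ℕ) (x : EuclideanSpace ℝ (Fin d)) :
    ∀ f : smoothFunctions d, multiD α (smoothTranslate x f) = smoothTranslate x (multiD α f) := by
  induction α using multiIndex_induction with
  | h0 => intro f; simp [multiD_zero]
  | hs α i ih =>
    intro f
    rw [multiD_add_single_apply, multiD_add_single_apply, partialD_smoothTranslate, ih]

/-- The complex conjugate of a smooth function. -/
def smoothConj (f : smoothFunctions d) : smoothFunctions d :=
  ⟨fun t => (starRingEnd ℂ) (f.1 t),
    Complex.conjCLE.contDiff.comp (smoothFunctions_contDiff f)⟩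

theorem partialD_smoothConj (i : Fin d) (f : smoothFunctions d) :
    partialD i (smoothConj f) = smoothConj (partialD i f) := by
  refine Subtype.ext (funext fun t => ?_)
  change fderiv ℝ (Complex.conjCLE ∘ f.1) t _ = (starRingEnd ℂ) (fderiv ℝ f.1 t _)
  rw [ContinuousLinearEquiv.comp_fderiv]
  rfl

theorem multiD_smoothConj (α : Fin d → ℕ) :
    ∀ f : smoothFunctions d, multiD α (smoothConj f) = smoothConj (multiD α f) := by
  induction α using multiIndex_induction with
  | h0 => intro f; simp [multiD_zero]
  | hs α i ih =>
    intro f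
    rw [multiD_add_single_apply, multiD_add_single_apply, partialD_smoothConj, ih]

theorem contDiff_fourierChar : ContDiff ℝ ∞ fun x : ℝ => (Real.fourierChar x : ℂ) := by
  simp only [Real.fourierChar_apply]
  exact ((Complex.ofRealCLM.contDiff.comp (contDiff_const.mul contDiff_id)).mul
    contDiff_const).cexp

/-- The character `t ↦ exp (2 π i ⟪ξ, t⟫)`. -/
noncomputable def smoothChar (ξ : EuclideanSpace ℝ (Fin d)) : smoothFunctions d :=
  ⟨fun t => (Real.fourierChar (inner ℝ ξ t) : ℂ),
    contDiff_fourierChar.comp (contDiff_const.inner ℝ contDiff_id)⟩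

theorem partialD_smoothChar (i : Fin d) (ξ : EuclideanSpace ℝ (Fin d)) :
    partialD i (smoothChar ξ) = (2 * Real.pi * Complex.I * ξ i) • smoothChar ξ := by
  refine Subtype.ext (funext fun t => ?_)
  have h1 : HasFDerivAt (fun t : EuclideanSpace ℝ (Fin d) => inner ℝ ξ t) (innerSL ℝ ξ) t :=
    (innerSL ℝ ξ).hasFDerivAt
  have h2 := (Real.hasDerivAt_fourierChar (inner ℝ ξ t)).hasFDerivAt.comp t h1
  change fderiv ℝ (fun t => (Real.fourierChar (inner ℝ ξ t) : ℂ)) t _ = _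
  rw [HasFDerivAt.fderiv (f := fun t => (Real.fourierChar (inner ℝ ξ t) : ℂ)) h2]
  change _ = (2 * Real.pi * Complex.I * ξ i) * (Real.fourierChar (inner ℝ ξ t) : ℂ)
  simp [EuclideanSpace.inner_single_right]
  ring

theorem norm_multiD_smoothChar_le (ξ t : EuclideanSpace ℝ (Fin d)) (α : Fin d → ℕ) :
    ‖(multiD α (smoothChar ξ)).1 t‖ ≤ (2 * Real.pi * ‖ξ‖) ^ ∑ i, α i := by
  induction α using multiIndex_induction with
  | h0 => simp only [multiD_zero, Module.End.one_apply, smoothChar, Circle.norm_coe]; simp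
  | hs α i ih =>
    rw [multiD_add_single_apply, partialD_smoothChar, map_smul, sum_add_single]
    have : ‖((2 * Real.pi * Complex.I * ξ i) • multiD α (smoothChar ξ)).1 t‖ =
        ‖(2 * Real.pi * Complex.I * ξ i : ℂ)‖ * ‖(multiD α (smoothChar ξ)).1 t‖ :=
      norm_smul (2 * Real.pi * Complex.I * ξ i : ℂ) ((multiD α (smoothChar ξ)).1 t)
    rw [this, pow_succ, mul_comm]
    gcongr
    have h := EuclideanSpace.norm_eq ξ
    have hi : ‖ξ i‖ ≤ ‖ξ‖ := PiLp.norm_apply_le ξ i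
    simp only [norm_mul, Complex.norm_real, Complex.norm_I, Complex.norm_ofNat, mul_one]
    rw [Real.norm_of_nonneg Real.pi_pos.le]
    gcongr

theorem continuous_multiD (α : Fin d → ℕ) (f : smoothFunctions d) : Continuous (multiD α f).1 :=
  (smoothFunctions_contDiff _).continuous

/-! ### The suprema defining the weighted spaces -/

theorem weightedSup_le_iff {c : ℕ → ℝ} {w : EuclideanSpace ℝ (Fin d) → ℝ}
    {φ : smoothFunctions d} {K : ℝ} (hK : 0 ≤ K) :
    weightedSup c w φ ≤ ENNReal.ofReal K ↔
      ∀ α x, c (∑ i, α i) * ‖(multiD α φ).1 x‖ * w x ≤ K := by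
  simp only [weightedSup, iSup_le_iff, ENNReal.ofReal_le_ofReal_iff hK]

theorem mem_weightedSpace_iff {c : ℕ → ℝ} {w : EuclideanSpace ℝ (Fin d) → ℝ}
    {φ : smoothFunctions d} : φ ∈ weightedSpace c w ↔
      ∃ K : ℝ, 0 ≤ K ∧ ∀ α x, c (∑ i, α i) * ‖(multiD α φ).1 x‖ * w x ≤ K := by
  constructor
  · intro h
    have h' : weightedSup c w φ < ⊤ := h
    refine ⟨(weightedSup c w φ).toReal, ENNReal.toReal_nonneg,
      (weightedSup_le_iff ENNReal.toReal_nonneg).1 ?_⟩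
    rw [ENNReal.ofReal_toReal h'.ne]
  · rintro ⟨K, hK, h⟩
    exact ((weightedSup_le_iff hK).2 h).trans_lt ENNReal.ofReal_lt_top

theorem weightedSeminorm_le_iff {c : ℕ → ℝ} {w : EuclideanSpace ℝ (Fin d) → ℝ}
    {φ : weightedSpace c w} {K : ℝ} (hK : 0 ≤ K) :
    weightedSeminorm c w φ ≤ K ↔
      ∀ α x, c (∑ i, α i) * ‖(multiD α φ.1).1 x‖ * w x ≤ K := by
  rw [← weightedSup_le_iff hK]
  exact (ENNReal.le_ofReal_iff_toReal_le (weightedSup_lt_top c w φ).ne hK).symm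

end

open MeasureTheory

section

variable {d : ℕ}

/-! ### Integrals of families of smooth functions -/

/-- The linear functional `y ↦ y_i a`, as a function of `a`. -/
noncomputable def coordSMul (i : Fin d) : ℂ →L[ℝ] EuclideanSpace ℝ (Fin d) →L[ℝ] ℂ :=
  ContinuousLinearMap.smulRightL ℝ (EuclideanSpace ℝ (Fin d)) ℂ (EuclideanSpace.proj i)

theorem coordSMul_apply (i : Fin d) (a : ℂ) (y : EuclideanSpace ℝ (Fin d)) :
    coordSMul i a y = y i • a := rfl

theorem norm_coordSMul_le (i : Fin d) (a : ℂ) : ‖coordSMul i a‖ ≤ ‖a‖ := by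
  refine ContinuousLinearMap.opNorm_le_bound _ (norm_nonneg a) fun y => ?_
  rw [coordSMul_apply, norm_smul, mul_comm]
  gcongr
  exact PiLp.norm_apply_le y i

theorem sum_coordSMul_single (a : Fin d → ℂ) (j : Fin d) :
    (∑ i, coordSMul i (a i)) (EuclideanSpace.single j 1) = a j := by
  rw [sum_apply, Finset.sum_eq_single j]
  · simp [coordSMul_apply]
  · intro i _ hij
    simp [coordSMul_apply, hij]
  · simp

theorem fderiv_eq_sum_partialD (φ : smoothFunctions d) (t : EuclideanSpace ℝ (Fin d)) :
    fderiv ℝ φ.1 t = ∑ i, coordSMul i ((partialD i φ).1 t) := by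
  refine ContinuousLinearMap.coe_injective
    ((EuclideanSpace.basisFun (Fin d) ℝ).toBasis.ext fun j => ?_)
  simp only [OrthonormalBasis.coe_toBasis, EuclideanSpace.basisFun_apply,
    ContinuousLinearMap.coe_coe]
  rw [sum_coordSMul_single, partialD_apply]

theorem hasFDerivAt_integral_sum_of_dominated_ball {H F G Ω ι : Type*} [NormedAddCommGroup H]
    [NormedSpace ℝ H] [NormedAddCommGroup F] [NormedSpace ℝ F] [NormedAddCommGroup G]
    [NormedSpace ℝ G] [CompleteSpace G] [CompleteSpace F] [MeasurableSpace Ω] [Fintype ι]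
    {μ : Measure Ω} (L : ι → G →L[ℝ] H →L[ℝ] F) (hL : ∀ i a, ‖L i a‖ ≤ ‖a‖)
    {f : H → Ω → F} {f' : ι → H → Ω → G} {bound : ι → Ω → ℝ} {t : H}
    (hmeas : ∀ y, AEStronglyMeasurable (f y) μ) (hint : Integrable (f t) μ)
    (hint' : ∀ i, Integrable (f' i t) μ)
    (hbound : ∀ i z, ∀ y ∈ Metric.ball t 1, ‖f' i y z‖ ≤ bound i z)
    (hg : ∀ i, Integrable (bound i) μ)
    (hderiv : ∀ z, ∀ y ∈ Metric.ball t 1, HasFDerivAt (fun y => f y z) (∑ i, L i (f' i y z)) y) :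
    HasFDerivAt (fun y => ∫ z, f y z ∂μ) (∑ i, L i (∫ z, f' i t z ∂μ)) t := by
  have hsum : ∑ i, L i (∫ z, f' i t z ∂μ) = ∫ z, ∑ i, L i (f' i t z) ∂μ := by
    rw [integral_finsetSum _ fun i _ => (L i).integrable_comp (hint' i)]
    exact Finset.sum_congr rfl fun i _ => ((L i).integral_comp_comm (hint' i)).symm
  rw [hsum]
  exact hasFDerivAt_integral_of_dominated_of_fderiv_le (𝕜 := ℝ) (bound := fun z => ∑ i, bound i z)
    (F' := fun y z => ∑ i, L i (f' i y z))
    (Metric.ball_mem_nhds t one_pos) (Eventually.of_forall hmeas) hint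
    (Finset.aestronglyMeasurable_fun_sum _ fun i _ =>
      (L i).continuous.comp_aestronglyMeasurable (hint' i).1)
    (ae_of_all _ fun z y hy => (norm_sum_le _ _).trans (Finset.sum_le_sum fun i _ =>
      (hL i _).trans (hbound i z y hy)))
    (integrable_finsetSum _ fun i _ => hg i) (ae_of_all _ hderiv)

theorem hasFDerivAt_multiD (φ : smoothFunctions d) (α : Fin d → ℕ)
    (y : EuclideanSpace ℝ (Fin d)) :
    HasFDerivAt (multiD α φ).1
      (∑ i, coordSMul i ((multiD (α + Pi.single i 1) φ).1 y)) y := by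
  have h1 := (smoothFunctions_differentiable (multiD α φ) y).hasFDerivAt
  rw [fderiv_eq_sum_partialD] at h1
  simp only [partialD_multiD] at h1
  exact h1

/-- The derivative of the integral of index `α` is a linear combination of those of index `α + e_i`,
so `C^n` regularity is proved for all `α` simultaneously by induction on `n`. -/
theorem contDiff_integral_multiIndex {Ω : Type*} [MeasurableSpace Ω] {μ : Measure Ω}
    {D : (Fin d → ℕ) → EuclideanSpace ℝ (Fin d) → Ω → ℂ}
    (hderiv : ∀ α z y, HasFDerivAt (fun y => D α y z)
      (∑ i, coordSMul i (D (α + Pi.single i 1) y z)) y)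
    (hint : ∀ α t, Integrable (D α t) μ)
    (hb : ∀ α t₀, ∃ g : Ω → ℝ, Integrable g μ ∧ ∀ t ∈ Metric.ball t₀ 1, ∀ z, ‖D α t z‖ ≤ g z) :
    (∀ α, ContDiff ℝ ∞ fun t => ∫ z, D α t z ∂μ) ∧
    ∀ α t i, fderiv ℝ (fun t => ∫ z, D α t z ∂μ) t (EuclideanSpace.single i 1) =
      ∫ z, D (α + Pi.single i 1) t z ∂μ := by
  have hd : ∀ α t, HasFDerivAt (fun t => ∫ z, D α t z ∂μ)
      (∑ i, coordSMul i (∫ z, D (α + Pi.single i 1) t z ∂μ)) t := by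
    intro α t
    obtain ⟨D', hD'⟩ : ∃ D' : Fin d → EuclideanSpace ℝ (Fin d) → Ω → ℂ,
      ∀ i, D (α + Pi.single i 1) = D' i := ⟨_, fun _ => rfl⟩
    have h1 := hderiv α
    simp only [hD'] at h1 ⊢
    choose g hg hgb using fun i => hb (α + Pi.single i 1) t
    simp only [hD'] at hgb
    exact hasFDerivAt_integral_sum_of_dominated_ball coordSMul norm_coordSMul_le
      (fun y => (hint α y).1) (hint α t) (fun i => hD' i ▸ hint _ t)
      (fun i z y hy => hgb i y hy z) hg fun z y _ => h1 z y
  have hsmooth : ∀ n : ℕ, ∀ α, ContDiff ℝ n fun t => ∫ z, D α t z ∂μ := by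
    intro n
    induction n with
    | zero =>
      intro α
      exact contDiff_zero.2 (continuous_iff_continuousAt.2 fun t => (hd α t).continuousAt)
    | succ n ih =>
      intro α
      have : ((n + 1 : ℕ) : WithTop ℕ∞) = (n : WithTop ℕ∞) + 1 := by push_cast; rfl
      rw [this, contDiff_succ_iff_fderiv]
      refine ⟨fun t => (hd α t).differentiableAt, by simp, ?_⟩
      rw [show fderiv ℝ _ = _ from funext fun t => (hd α t).fderiv]
      exact ContDiff.sum fun i _ => (coordSMul i).contDiff.comp (ih _)
  refine ⟨fun α => contDiff_infty.2 fun n => hsmooth n α, fun α t i => ?_⟩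
  rw [(hd α t).fderiv, sum_coordSMul_single]

theorem exists_smooth_integral {Ω : Type*} [MeasurableSpace Ω] (μ : Measure Ω)
    (Φ : Ω → smoothFunctions d)
    (hmeas : ∀ α t, AEStronglyMeasurable (fun z => (multiD α (Φ z)).1 t) μ)
    (hb : ∀ α t₀, ∃ g : Ω → ℝ, Integrable g μ ∧
      ∀ t ∈ Metric.ball t₀ 1, ∀ z, ‖(multiD α (Φ z)).1 t‖ ≤ g z) :
    ∃ φ : smoothFunctions d, ∀ α t, Integrable (fun z => (multiD α (Φ z)).1 t) μ ∧
      (multiD α φ).1 t = ∫ z, (multiD α (Φ z)).1 t ∂μ := by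
  have hint : ∀ α t, Integrable (fun z => (multiD α (Φ z)).1 t) μ := fun α t => by
    obtain ⟨g, hg, h⟩ := hb α t
    exact hg.mono' (hmeas α t) (ae_of_all _ (h t (Metric.mem_ball_self one_pos)))
  obtain ⟨hsmooth, hderiv⟩ := contDiff_integral_multiIndex
    (D := fun α t z => (multiD α (Φ z)).1 t) (fun α z y => hasFDerivAt_multiD (Φ z) α y) hint hb
  let φ : (Fin d → ℕ) → smoothFunctions d := fun α => ⟨_, hsmooth α⟩
  have hpart : ∀ i α, partialD i (φ α) = φ (α + Pi.single i 1) := fun i α =>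
    Subtype.ext (funext fun t => hderiv α t i)
  have hmulti : ∀ α β, multiD α (φ β) = φ (α + β) := by
    intro α
    induction α using multiIndex_induction with
    | h0 => intro β; simp [multiD_zero]
    | hs α i ih =>
      intro β
      rw [multiD_add_single_apply, hpart, ih, add_assoc, add_comm β]
  refine ⟨φ 0, fun α t => ⟨hint α t, ?_⟩⟩
  rw [hmulti, add_zero]

/-! ### Windows -/

/-- A window: a smooth function whose derivatives of order `p` are `O(M_p exp (-A(τ ·)))` for
every `τ`, with an additional polynomial factor. -/
def IsWindow (M A : ℕ → ℝ) (ψ : smoothFunctions d) : Prop :=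
  ∀ τ : ℝ, 0 < τ → ∃ C : ℝ, 0 < C ∧ ∀ α s, ‖(multiD α ψ).1 s‖ *
    (Real.exp (assocFun A (τ * ‖s‖)) * (1 + ‖s‖) ^ (d + 1)) ≤ C * M (∑ i, α i)

theorem isWindow_of_mem_beurlingSpace {M A : ℕ → ℝ} (hM : ∀ p, 0 < M p)
    (hA : IsWeightSequence A) (hA2 : ConditionM2' A) {ψ : smoothFunctions d}
    (hψ : ψ ∈ beurlingSpace d M A) : IsWindow M A ψ := by
  intro τ hτ
  obtain ⟨C, H, hC, hH, hCH⟩ := exists_one_add_pow_mul_exp_assocFun_le hA hA2 (d + 1)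
  simp only [beurlingSpace, Submodule.mem_iInf] at hψ
  obtain ⟨K, hK, hb⟩ := mem_weightedSpace_iff.1 (hψ ⟨1, Set.mem_Ioi.2 one_pos⟩
    ⟨H * τ, Set.mem_Ioi.2 (mul_pos hH hτ)⟩)
  refine ⟨(1 + 1 / τ) ^ (d + 1) * C * (K + 1), by positivity, fun α s => ?_⟩
  have h1 := hb α s
  simp only [stepCoeff, one_pow, norm_smul, Real.norm_eq_abs, abs_of_pos (mul_pos hH hτ)] at h1
  have hMp := hM (∑ i, α i)
  have h2 : ‖(multiD α ψ).1 s‖ * Real.exp (assocFun A (H * τ * ‖s‖)) ≤ K * M (∑ i, α i) := by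
    rw [one_div, mul_assoc, inv_mul_le_iff₀ hMp] at h1
    linarith
  -- The polynomial weight is rescaled to the variable `τ * ‖s‖` so that it can be absorbed by
  -- passing from `τ` to `H * τ`.
  have h3 : (1 + ‖s‖) ^ (d + 1) ≤ (1 + 1 / τ) ^ (d + 1) * (1 + τ * ‖s‖) ^ (d + 1) := by
    rw [← mul_pow]
    gcongr
    have e : (1 + 1 / τ) * (1 + τ * ‖s‖) = 1 + ‖s‖ + (1 / τ + τ * ‖s‖) := by
      field_simp; ring
    rw [e]
    have : 0 ≤ 1 / τ + τ * ‖s‖ := by positivity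
    linarith
  have h4 := hCH (τ * ‖s‖) (by positivity)
  rw [← mul_assoc] at h4
  calc ‖(multiD α ψ).1 s‖ * (Real.exp (assocFun A (τ * ‖s‖)) * (1 + ‖s‖) ^ (d + 1))
      ≤ ‖(multiD α ψ).1 s‖ * (Real.exp (assocFun A (τ * ‖s‖)) *
          ((1 + 1 / τ) ^ (d + 1) * (1 + τ * ‖s‖) ^ (d + 1))) := by gcongr
    _ = (1 + 1 / τ) ^ (d + 1) * ‖(multiD α ψ).1 s‖ *
          ((1 + τ * ‖s‖) ^ (d + 1) * Real.exp (assocFun A (τ * ‖s‖))) := by ring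
    _ ≤ (1 + 1 / τ) ^ (d + 1) * ‖(multiD α ψ).1 s‖ *
          (C * Real.exp (assocFun A (H * τ * ‖s‖))) := by gcongr
    _ = (1 + 1 / τ) ^ (d + 1) * C *
          (‖(multiD α ψ).1 s‖ * Real.exp (assocFun A (H * τ * ‖s‖))) := by ring
    _ ≤ (1 + 1 / τ) ^ (d + 1) * C * (K * M (∑ i, α i)) := by gcongr
    _ ≤ (1 + 1 / τ) ^ (d + 1) * C * ((K + 1) * M (∑ i, α i)) := by gcongr; linarith
    _ = _ := by ring

theorem IsWindow.conj {M A : ℕ → ℝ} {ψ : smoothFunctions d} (h : IsWindow M A ψ) :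
    IsWindow M A (smoothConj ψ) := by
  intro τ hτ
  obtain ⟨C, hC, hb⟩ := h τ hτ
  refine ⟨C, hC, fun α s => ?_⟩
  rw [multiD_smoothConj]
  have : ‖(smoothConj (multiD α ψ)).1 s‖ = ‖(multiD α ψ).1 s‖ := RCLike.norm_conj _
  rw [this]
  exact hb α s

/-- The integrable weight `(1 + ‖y‖)^{-(d+1)}`. -/
noncomputable def decay (y : EuclideanSpace ℝ (Fin d)) : ℝ := ((1 + ‖y‖) ^ (d + 1))⁻¹

theorem decay_pos (y : EuclideanSpace ℝ (Fin d)) : 0 < decay y := by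
  unfold decay; positivity

theorem integrable_decay : Integrable (decay (d := d)) := by
  have h := integrable_one_add_norm (E := EuclideanSpace ℝ (Fin d)) (μ := volume)
    (r := (d : ℝ) + 1) (by simp)
  refine h.congr (ae_of_all _ fun y => ?_)
  have : (0 : ℝ) ≤ 1 + ‖y‖ := by positivity
  simp only [decay]
  rw [Real.rpow_neg this]
  congr 1
  exact_mod_cast Real.rpow_natCast (1 + ‖y‖) (d + 1)

theorem decay_le_of_dist_le {x y : EuclideanSpace ℝ (Fin d)} (h : ‖x - y‖ ≤ 1) :
    decay x ≤ 2 ^ (d + 1) * decay y := by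
  unfold decay
  rw [← div_eq_mul_inv, le_div_iff₀ (by positivity), inv_mul_le_iff₀ (by positivity), ← mul_pow]
  gcongr
  have : ‖y‖ ≤ ‖x‖ + ‖x - y‖ := by
    rw [← norm_neg (x - y), neg_sub]
    calc ‖y‖ = ‖x + (y - x)‖ := by rw [add_sub_cancel]
      _ ≤ _ := norm_add_le _ _
  linarith [norm_nonneg x]

theorem sum_antidiagonal_choose_mul_pow_le {M : ℕ → ℝ} (hM : ∀ p, 0 < M p) (hM1 : ConditionM1 M)
    {κ : ℝ} (hκ : 0 ≤ κ) (p : ℕ) :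
    ∑ ij ∈ Finset.HasAntidiagonal.antidiagonal p, (p.choose ij.1 : ℝ) *
      (κ ^ ij.1 * M ij.1 * M ij.2) ≤ (κ + 1) ^ p * (M 0 * M p) := by
  rw [(Commute.all κ 1).add_pow', Finset.sum_mul]
  refine Finset.sum_le_sum fun ij hij => ?_
  rw [← Finset.HasAntidiagonal.mem_antidiagonal.1 hij]
  have := hM1.mul_le hM ij.1 ij.2
  simp only [one_pow, mul_one, nsmul_eq_mul, mul_assoc]
  gcongr

theorem continuous_multiD_char_mul_translate (t : EuclideanSpace ℝ (Fin d)) (α : Fin d → ℕ) :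
    ∀ f : smoothFunctions d, Continuous fun z : EuclideanSpace ℝ (Fin d) ×
      EuclideanSpace ℝ (Fin d) =>
        (multiD α (smoothMul (smoothChar z.2) (smoothTranslate z.1 f))).1 t := by
  induction α using multiIndex_induction with
  | h0 =>
    intro f
    simp only [multiD_zero, Module.End.one_apply]
    change Continuous fun z : EuclideanSpace ℝ (Fin d) × EuclideanSpace ℝ (Fin d) =>
      (Real.fourierChar (inner ℝ z.2 t) : ℂ) * f.1 (t - z.1)
    refine Continuous.mul ?_ ((smoothFunctions_contDiff f).continuous.comp (by fun_prop))
    exact (contDiff_fourierChar.continuous).comp (by fun_prop)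
  | hs α i ih =>
    intro f
    have h : ∀ z : EuclideanSpace ℝ (Fin d) × EuclideanSpace ℝ (Fin d),
        (multiD (α + Pi.single i 1) (smoothMul (smoothChar z.2) (smoothTranslate z.1 f))).1 t =
        (2 * Real.pi * Complex.I * z.2 i) *
          (multiD α (smoothMul (smoothChar z.2) (smoothTranslate z.1 f))).1 t +
        (multiD α (smoothMul (smoothChar z.2) (smoothTranslate z.1 (partialD i f)))).1 t := by
      intro z
      rw [multiD_add_single_apply, partialD_smoothMul, partialD_smoothChar,
        partialD_smoothTranslate, map_add]
      have : smoothMul ((2 * Real.pi * Complex.I * z.2 i : ℂ) • smoothChar z.2)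
          (smoothTranslate z.1 f) = (2 * Real.pi * Complex.I * z.2 i : ℂ) •
            smoothMul (smoothChar z.2) (smoothTranslate z.1 f) := by
        refine Subtype.ext (funext fun s => ?_)
        exact mul_assoc _ _ _
      rw [this, map_smul]
      rfl
    simp only [h]
    refine Continuous.add (Continuous.mul ?_ (ih f)) (ih _)
    fun_prop

end

section

variable {d : ℕ}

/-! ### Synthesis -/

theorem IsWindow.exists_translate_bound {M A : ℕ → ℝ} {ψ : smoothFunctions d}
    (h : IsWindow M A ψ) {τ : ℝ} (hτ : 0 < τ) : ∃ C : ℝ, 0 < C ∧ ∀ α t x,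
      ‖(multiD α (smoothTranslate x ψ)).1 t‖ ≤ C * M (∑ i, α i) *
        ((Real.exp (assocFun A (τ * ‖t - x‖)))⁻¹ * decay (t - x)) := by
  obtain ⟨C, hC, hb⟩ := h τ hτ
  refine ⟨C, hC, fun α t x => ?_⟩
  rw [multiD_smoothTranslate, decay, ← mul_inv, ← div_eq_mul_inv, le_div_iff₀ (by positivity)]
  exact hb α (t - x)

/-- Spending `m` additional moments buys decay `(1 + s)^{-m}`; by `(M.2)'` this only enlarges `κ` to
`κ * H`. With `m = d + 1` it gives integrability in the frequency. -/
theorem mul_one_add_pow_le_of_moments {M : ℕ → ℝ} (hM : ∀ p, 0 < M p) {C H : ℝ}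
    (hH : 1 ≤ H) {m : ℕ} (hshift : ∀ p, M (p + m) ≤ C * H ^ p * M p) {y b s κ : ℝ} (hy : 0 ≤ y)
    (hb : 0 ≤ b) (hs : 0 ≤ s) (hκ : 0 ≤ κ) (h : ∀ p, y * s ^ p ≤ b * (κ ^ p * M p)) (j : ℕ) :
    y * s ^ j * (1 + s) ^ m ≤ b * (2 ^ m * (1 + κ ^ m * C)) * ((κ * H) ^ j * M j) := by
  have hMj := hM j
  have h1 : κ ^ j * M j ≤ (κ * H) ^ j * M j := by
    gcongr
    exact le_mul_of_one_le_right hκ hH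
  calc y * s ^ j * (1 + s) ^ m ≤ y * s ^ j * (2 ^ m * (1 + s ^ m)) := by
        gcongr; exact one_add_pow_le m hs
    _ = 2 ^ m * (y * s ^ j + y * s ^ (j + m)) := by ring
    _ ≤ 2 ^ m * (b * (κ ^ j * M j) + b * (κ ^ (j + m) * M (j + m))) := by
        have := add_le_add (h j) (h (j + m))
        gcongr
    _ ≤ 2 ^ m * (b * ((κ * H) ^ j * M j) + b * (κ ^ (j + m) * (C * H ^ j * M j))) := by
        gcongr
        exact hshift j
    _ = _ := by rw [mul_pow]; ring

theorem norm_multiD_char_mul_le {M : ℕ → ℝ} (hM : ∀ p, 0 < M p) (hM1 : ConditionM1 M)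
    {f : smoothFunctions d} {t ξ : EuclideanSpace ℝ (Fin d)} {y D κ w B : ℝ} (hy : 0 ≤ y)
    (hw : 0 ≤ w) (hB : 0 ≤ B) (hκ : 0 ≤ κ) (hf : ∀ β, ‖(multiD β f).1 t‖ ≤ B * M (∑ i, β i))
    (hmom : ∀ j, y * ‖ξ‖ ^ j ≤ D * (κ ^ j * M j) * w) (hD : 0 ≤ D) (α : Fin d → ℕ) :
    y * ‖(multiD α (smoothMul (smoothChar ξ) f)).1 t‖ ≤
      D * w * B * ((2 * Real.pi * κ + 1) ^ (∑ i, α i) * (M 0 * M (∑ i, α i))) := by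
  have hpi := Real.pi_pos
  have h1 := norm_multiD_smoothMul_le t α (smoothChar ξ) f _ (fun p => B * M p)
    (fun β => norm_multiD_smoothChar_le ξ t β) hf
  refine (mul_le_mul_of_nonneg_left h1 hy).trans ?_
  refine le_trans ?_ (mul_le_mul_of_nonneg_left (sum_antidiagonal_choose_mul_pow_le hM hM1
    (κ := 2 * Real.pi * κ) (by positivity) (∑ i, α i)) (by positivity))
  rw [Finset.mul_sum, Finset.mul_sum]
  refine Finset.sum_le_sum fun ij _ => ?_
  have h2 := hmom ij.1
  have h3 := (hM ij.2).le
  calc y * (((∑ i, α i).choose ij.1 : ℝ) * ((2 * Real.pi * ‖ξ‖) ^ ij.1 * (B * M ij.2)))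
      = ((∑ i, α i).choose ij.1 : ℝ) * (2 * Real.pi) ^ ij.1 * (B * M ij.2) *
          (y * ‖ξ‖ ^ ij.1) := by rw [mul_pow _ ‖ξ‖]; ring
    _ ≤ ((∑ i, α i).choose ij.1 : ℝ) * (2 * Real.pi) ^ ij.1 * (B * M ij.2) *
          (D * (κ ^ ij.1 * M ij.1) * w) := by gcongr
    _ = _ := by rw [mul_pow _ κ]; ring

theorem smoothMul_smul_left_multiD (a : ℂ) (f : smoothFunctions d) (α : Fin d → ℕ)
    (t : EuclideanSpace ℝ (Fin d)) : (multiD α (a • f)).1 t = a * (multiD α f).1 t := by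
  rw [map_smul]
  rfl

/-- Derivatives of `exp(2πi⟪ξ,t⟫) ψ(t - x)` cost powers of `|ξ|`, which the moments of `G` convert
into `M_j`, and `(M.1)` reassembles `M_{|α|}`. Admissibility moves the weight from `x` to `t` at the
cost of `exp(A(τ(t - x)))`, which the decay of the window cancels, leaving an integrable factor. -/
theorem exists_synthesis {M A : ℕ → ℝ} (hM : IsWeightSequence M) (hM1 : ConditionM1 M)
    (hM2 : ConditionM2' M) {v : ℕ → EuclideanSpace ℝ (Fin d) → ℝ}
    (hv : IsDecreasingWeightSystem v) (hadm : IsAdmissible A v) {ψ : smoothFunctions d}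
    (hψ : IsWindow M A ψ) (k : ℕ) :
    ∃ k' : ℕ, ∃ C : ℝ, 0 < C ∧
      ∀ (G : EuclideanSpace ℝ (Fin d) × EuclideanSpace ℝ (Fin d) → ℂ) (b : ℝ), 0 ≤ b →
      StronglyMeasurable G →
      (∀ z p, ‖G z‖ * v k z.1 * ‖z.2‖ ^ p ≤ b * (((k : ℝ) + 1) ^ p * M p)) →
      ∃ φ : smoothFunctions d,
        (∀ t, Integrable
          (fun z => G z * (smoothMul (smoothChar z.2) (smoothTranslate z.1 ψ)).1 t) ∧
          φ.1 t = ∫ z, G z * (smoothMul (smoothChar z.2) (smoothTranslate z.1 ψ)).1 t) ∧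
        ∀ α t, ‖(multiD α φ).1 t‖ * v k' t ≤
          C * b * (((k' : ℝ) + 1) ^ (∑ i, α i) * M (∑ i, α i)) := by
  obtain ⟨τ, hτ, hadm⟩ := hadm
  obtain ⟨m, -, C₃, hC₃, hm⟩ := hadm k
  obtain ⟨C₁, hC₁, hwin⟩ := hψ.exists_translate_bound hτ
  obtain ⟨C, H, hC, hH, hshift⟩ := hM2.exists_shift_le (d + 1)
  have hpi := Real.pi_pos
  have hM0 := hM.1 0
  set κ₀ : ℝ := ((k : ℝ) + 1) * H with hκ₀
  have hκ₀0 : 0 ≤ κ₀ := by positivity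
  set κ : ℝ := 2 * Real.pi * κ₀ + 1 with hκ
  obtain ⟨n, hn⟩ := exists_nat_ge κ
  set C₂ : ℝ := 2 ^ (d + 1) * (1 + ((k : ℝ) + 1) ^ (d + 1) * C) with hC₂
  have hC₂0 : 0 < C₂ := by positivity
  set S : ℝ := ∫ y : EuclideanSpace ℝ (Fin d), decay y with hS
  have hS0 : 0 ≤ S := integral_nonneg fun y => (decay_pos y).le
  set D : ℝ := C₃ * C₁ * C₂ * M 0 with hD
  have hD0 : 0 < D := by positivity
  have hvanti : ∀ x, Antitone fun k => v k x := fun x => antitone_nat_of_succ_le fun k => hv.2.2 k x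
  refine ⟨max m n, D * (S * S) + 1, by positivity, fun G b hb hG hGb => ?_⟩
  have hadm' : ∀ x t, v m t ≤ C₃ * v k x * Real.exp (assocFun A (τ * ‖t - x‖)) := by
    intro x t
    have := hm x (t - x)
    rwa [add_sub_cancel, norm_smul, Real.norm_of_nonneg hτ.le] at this
  have hbound : ∀ α t z, v m t * ‖(multiD α (G z • smoothMul (smoothChar z.2)
      (smoothTranslate z.1 ψ))).1 t‖ ≤
        D * b * (κ ^ (∑ i, α i) * M (∑ i, α i)) * (decay (t - z.1) * decay z.2) := by
    intro α t z
    rw [smoothMul_smul_left_multiD, norm_mul]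
    have hvk := hv.2.1 k z.1
    have hdec := decay_pos (t - z.1)
    have hdec2 := decay_pos z.2
    set e := Real.exp (assocFun A (τ * ‖t - z.1‖)) with he
    have he0 : 0 < e := Real.exp_pos _
    have hmom : ∀ j, (‖G z‖ * v k z.1) * ‖z.2‖ ^ j ≤ (b * C₂) * (κ₀ ^ j * M j) * decay z.2 := by
      intro j
      rw [decay, ← div_eq_mul_inv, le_div_iff₀ (by positivity)]
      exact mul_one_add_pow_le_of_moments hM.1 hH hshift (by positivity) hb (norm_nonneg _)
        (by positivity) (hGb z) j
    have h1 := norm_multiD_char_mul_le (B := C₁ * (e⁻¹ * decay (t - z.1))) hM.1 hM1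
      (mul_nonneg (norm_nonneg _) hvk.le) hdec2.le (by positivity) hκ₀0
      (fun β => (hwin β t z.1).trans_eq (by ring)) hmom (by positivity) α
    calc v m t * (‖G z‖ * ‖(multiD α (smoothMul (smoothChar z.2) (smoothTranslate z.1 ψ))).1 t‖)
        ≤ (C₃ * v k z.1 * e) *
          (‖G z‖ * ‖(multiD α (smoothMul (smoothChar z.2) (smoothTranslate z.1 ψ))).1 t‖) := by
          gcongr
          exact hadm' z.1 t
      _ = C₃ * e * (‖G z‖ * v k z.1 *
          ‖(multiD α (smoothMul (smoothChar z.2) (smoothTranslate z.1 ψ))).1 t‖) := by ring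
      _ ≤ C₃ * e * (b * C₂ * decay z.2 * (C₁ * (e⁻¹ * decay (t - z.1))) *
          (κ ^ (∑ i, α i) * (M 0 * M (∑ i, α i)))) := by gcongr
      _ = _ := by rw [hD]; field_simp
  have hint : ∀ t : EuclideanSpace ℝ (Fin d), Integrable
      (fun z : EuclideanSpace ℝ (Fin d) × EuclideanSpace ℝ (Fin d) =>
        decay (t - z.1) * decay z.2) := by
    intro t
    rw [Measure.volume_eq_prod]
    exact Integrable.mul_prod (integrable_decay.comp_sub_left t) integrable_decay
  have hintv : ∀ t : EuclideanSpace ℝ (Fin d),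
      ∫ z : EuclideanSpace ℝ (Fin d) × EuclideanSpace ℝ (Fin d),
        decay (t - z.1) * decay z.2 = S * S := by
    intro t
    rw [Measure.volume_eq_prod, integral_prod_mul (fun x => decay (t - x)) decay,
      integral_sub_left_eq_self]
  have hMp : ∀ α : Fin d → ℕ, 0 < M (∑ i, α i) := fun α => hM.1 _
  obtain ⟨φ, hφ⟩ := exists_smooth_integral (volume :
      Measure (EuclideanSpace ℝ (Fin d) × EuclideanSpace ℝ (Fin d)))
    (fun z => G z • smoothMul (smoothChar z.2) (smoothTranslate z.1 ψ))
    (fun α t => by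
      simp only [smoothMul_smul_left_multiD]
      exact (hG.mul (continuous_multiD_char_mul_translate t α ψ).stronglyMeasurable
        ).aestronglyMeasurable)
    (fun α t₀ => by
      -- The minimum of `v m` on a closed unit ball makes the domination uniform in `t` near `t₀`.
      obtain ⟨x₀, -, hx₀⟩ := (isCompact_closedBall t₀ 1).exists_isMinOn
        ⟨t₀, Metric.mem_closedBall_self zero_le_one⟩ (hv.1 m).continuousOn
      have hv0 := hv.2.1 m x₀
      refine ⟨fun z => (v m x₀)⁻¹ * (D * b * (κ ^ (∑ i, α i) * M (∑ i, α i)) * 2 ^ (d + 1)) *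
        (decay (t₀ - z.1) * decay z.2), (hint t₀).const_mul _, fun t ht z => ?_⟩
      have h1 := hbound α t z
      have h2 : v m x₀ ≤ v m t := hx₀ (Metric.ball_subset_closedBall ht)
      have h3 : decay (t - z.1) ≤ 2 ^ (d + 1) * decay (t₀ - z.1) := by
        refine decay_le_of_dist_le ?_
        rw [sub_sub_sub_cancel_right, ← dist_eq_norm]
        exact (Metric.mem_ball.1 ht).le
      have h4 := decay_pos z.2
      have h5 := hMp α
      have h6 : 0 ≤ κ := by positivity
      beta_reduce
      rw [mul_assoc (v m x₀)⁻¹, le_inv_mul_iff₀ hv0]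
      calc _ ≤ v m t * _ := mul_le_mul_of_nonneg_right h2 (norm_nonneg _)
        _ ≤ _ := h1
        _ ≤ D * b * (κ ^ (∑ i, α i) * M (∑ i, α i)) *
            ((2 ^ (d + 1) * decay (t₀ - z.1)) * decay z.2) := by gcongr
        _ = _ := by ring)
  refine ⟨φ, fun t => ?_, fun α t => ?_⟩
  · have h := hφ 0 t
    simp only [smoothMul_smul_left_multiD] at h
    simpa only [multiD_zero, Module.End.one_apply] using h
  · have hvm := hv.2.1 m t
    have h5 := hMp α
    have h6 : 0 ≤ κ := by positivity
    have h1 : v m t * ‖(multiD α φ).1 t‖ ≤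
        D * b * (κ ^ (∑ i, α i) * M (∑ i, α i)) * (S * S) := by
      rw [(hφ α t).2, ← hintv t, ← integral_const_mul]
      calc _ ≤ v m t * ∫ z, ‖(multiD α (G z • smoothMul (smoothChar z.2)
            (smoothTranslate z.1 ψ))).1 t‖ := by
            gcongr; exact norm_integral_le_integral_norm _
        _ = ∫ z, v m t * ‖(multiD α (G z • smoothMul (smoothChar z.2)
            (smoothTranslate z.1 ψ))).1 t‖ := (integral_const_mul _ _).symm
        _ ≤ _ := integral_mono ((hφ α t).1.norm.const_mul _) ((hint t).const_mul _)
            (hbound α t)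
    have h7 : κ ≤ ((max m n : ℕ) : ℝ) + 1 := by
      have : (n : ℝ) ≤ (max m n : ℕ) := by exact_mod_cast le_max_right m n
      linarith
    calc _ ≤ ‖(multiD α φ).1 t‖ * v m t := by
          gcongr
          exact hvanti t (le_max_left m n)
      _ ≤ D * b * (κ ^ (∑ i, α i) * M (∑ i, α i)) * (S * S) := by linarith
      _ = D * (S * S) * b * (κ ^ (∑ i, α i) * M (∑ i, α i)) := by ring
      _ ≤ _ := by
        gcongr
        linarith

/-! ### The short-time Fourier transform -/

open FourierTransform in
/-- The short-time Fourier transform of `φ` with window `conj χ`. -/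
noncomputable def stft (χ φ : smoothFunctions d)
    (z : EuclideanSpace ℝ (Fin d) × EuclideanSpace ℝ (Fin d)) : ℂ :=
  𝓕 (smoothMul φ (smoothTranslate z.1 χ)).1 z.2

theorem stronglyMeasurable_stft (χ φ : smoothFunctions d) : StronglyMeasurable (stft χ φ) := by
  have h : stft χ φ = fun z : EuclideanSpace ℝ (Fin d) × EuclideanSpace ℝ (Fin d) =>
      ∫ t, (Real.fourierChar (-inner ℝ t z.2) : ℂ) * (φ.1 t * χ.1 (t - z.1)) := by
    ext z
    rw [stft, Real.fourier_eq]
    rfl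
  rw [h]
  have hc : Continuous fun w : (EuclideanSpace ℝ (Fin d) × EuclideanSpace ℝ (Fin d)) ×
      EuclideanSpace ℝ (Fin d) =>
        (Real.fourierChar (-inner ℝ w.2 w.1.2) : ℂ) * (φ.1 w.2 * χ.1 (w.2 - w.1.1)) := by
    refine Continuous.mul ?_ (((smoothFunctions_contDiff φ).continuous.comp continuous_snd).mul
      ((smoothFunctions_contDiff χ).continuous.comp (by fun_prop)))
    exact contDiff_fourierChar.continuous.comp (by fun_prop)
  exact hc.stronglyMeasurable.integral_prod_right'

theorem integrable_sum_clm {H F G Ω ι : Type*} [NormedAddCommGroup H]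
    [NormedSpace ℝ H] [NormedAddCommGroup F] [NormedSpace ℝ F] [NormedAddCommGroup G]
    [NormedSpace ℝ G] [MeasurableSpace Ω] [Fintype ι] {μ : Measure Ω} (L : ι → G →L[ℝ] H →L[ℝ] F)
    {g : ι → Ω → G} (hg : ∀ i, Integrable (g i) μ) :
    Integrable (fun z => ∑ i, L i (g i z)) μ := by
  have h : ∀ i, Integrable (fun z => L i (g i z)) μ := fun i => (L i).integrable_comp (hg i)
  exact integrable_finsetSum (f := fun i z => L i (g i z)) _ fun i _ => h i

open FourierTransform in
theorem fourier_partialD {F : smoothFunctions d} (hF : ∀ α, Integrable (multiD α F).1) (i : Fin d)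
    (ξ : EuclideanSpace ℝ (Fin d)) :
    𝓕 (partialD i F).1 ξ = (2 * Real.pi * Complex.I * ξ i) * 𝓕 F.1 ξ := by
  have h0 : Integrable F.1 := by simpa [multiD_zero] using hF 0
  have h1 : ∀ j, Integrable (partialD j F).1 := fun j => by
    simpa [multiD_single] using hF (Pi.single j 1)
  have h2 : Integrable (fderiv ℝ F.1) := by
    rw [show fderiv ℝ F.1 = _ from funext fun t => fderiv_eq_sum_partialD F t]
    exact integrable_sum_clm coordSMul h1
  have h3 := congrFun (Real.fourier_fderiv h0 (smoothFunctions_differentiable F) h2) ξ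
  have h4 := congrArg (fun T => T (EuclideanSpace.single i (1 : ℝ))) h3
  simp only [Real.fourier_continuousLinearMap_apply h2] at h4
  change 𝓕 (fun t => fderiv ℝ F.1 t (EuclideanSpace.single i 1)) ξ = _
  rw [h4]
  have h5 : innerSL ℝ ξ (EuclideanSpace.single i (1 : ℝ)) = ξ i := by
    rw [innerSL_apply_apply, EuclideanSpace.inner_single_right]
    simp
  simp [VectorFourier.fourierSMulRight_apply, h5]
  ring

open FourierTransform in
theorem fourier_partialD_pow {F : smoothFunctions d} (hF : ∀ α, Integrable (multiD α F).1)
    (i : Fin d) (ξ : EuclideanSpace ℝ (Fin d)) (p : ℕ) :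
    𝓕 (multiD (Pi.single i p) F).1 ξ = (2 * Real.pi * Complex.I * ξ i) ^ p * 𝓕 F.1 ξ := by
  induction p with
  | zero => simp [multiD_zero]
  | succ p ih =>
    have h : multiD (Pi.single i (p + 1)) F = partialD i (multiD (Pi.single i p) F) := by
      rw [multiD_single, multiD_single, pow_succ']
      rfl
    rw [h, fourier_partialD (fun α => ?_), ih, pow_succ]
    · ring
    · have := hF (α + Pi.single i p)
      rw [multiD_add] at this
      exact this

theorem exists_norm_le_mul_coord (ξ : EuclideanSpace ℝ (Fin d)) (hξ : ξ ≠ 0) :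
    ∃ i, ‖ξ‖ ≤ ((d : ℝ) + 1) * |ξ i| := by
  by_contra! h
  have h1 : ‖ξ‖ ≤ ∑ i, |ξ i| := by
    conv_lhs => rw [← (EuclideanSpace.basisFun (Fin d) ℝ).sum_repr ξ]
    refine (norm_sum_le _ _).trans (Finset.sum_le_sum fun i _ => ?_)
    simp [norm_smul]
  have h2 : ((d : ℝ) + 1) * ∑ i, |ξ i| ≤ d * ‖ξ‖ := by
    rw [Finset.mul_sum]
    refine (Finset.sum_le_card_nsmul _ _ ‖ξ‖ fun i _ => (h i).le).trans_eq ?_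
    simp
  have h3 : 0 < ‖ξ‖ := norm_pos_iff.2 hξ
  have h4 : ((d : ℝ) + 1) * ‖ξ‖ ≤ ((d : ℝ) + 1) * ∑ i, |ξ i| := by gcongr
  linarith

open FourierTransform in
-- Derivatives of `φ · χ(· - x)` become powers of `ξ` under the Fourier transform, and the window
-- absorbs the exponential growth away from `x`. The free sequence `a` allows both uses: `r_0 ⋯ r_p`
-- for a projective seminorm and `(n+1)^p` for a step.
theorem exists_stft_bound {M A : ℕ → ℝ} (hM : ∀ p, 0 < M p) (hM1 : ConditionM1 M)
    {χ : smoothFunctions d} (hχ : IsWindow M A χ) {τ : ℝ} (hτ : 0 < τ) :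
    ∃ C : ℝ, 0 < C ∧ ∀ (φ : smoothFunctions d) (x : EuclideanSpace ℝ (Fin d)) (W Q : ℝ)
      (a : ℕ → ℝ), 0 < W → 0 ≤ Q → Monotone a → (∀ p, 0 ≤ a p) →
      (∀ α t, W * ‖(multiD α φ).1 t‖ ≤ Q * (M (∑ i, α i) * a (∑ i, α i)) *
        Real.exp (assocFun A (τ * ‖t - x‖))) →
      (∀ α, Integrable (multiD α (smoothMul φ (smoothTranslate x χ))).1) ∧
      ∀ ξ p, W * ‖stft χ φ (x, ξ)‖ * ‖ξ‖ ^ p ≤ C * Q * (((d : ℝ) + 1) ^ p * (M p * a p)) := by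
  obtain ⟨C₁, hC₁, hwin⟩ := hχ.exists_translate_bound hτ
  set S : ℝ := ∫ y : EuclideanSpace ℝ (Fin d), decay y with hS
  have hS0 : 0 ≤ S := integral_nonneg fun y => (decay_pos y).le
  have hM0 := hM 0
  refine ⟨C₁ * M 0 * S + 1, by positivity, fun φ x W Q a hW hQ ha ha0 hφ => ?_⟩
  set F := smoothMul φ (smoothTranslate x χ) with hF
  have hbound : ∀ α t, ‖(multiD α F).1 t‖ ≤ W⁻¹ * (C₁ * M 0 * Q *
      (2 ^ (∑ i, α i) * (M (∑ i, α i) * a (∑ i, α i)))) * decay (t - x) := by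
    intro α t
    set e := Real.exp (assocFun A (τ * ‖t - x‖)) with he
    have he0 : 0 < e := Real.exp_pos _
    have hdec := decay_pos (t - x)
    have h1 := norm_multiD_smoothMul_le t α φ (smoothTranslate x χ)
      (fun p => W⁻¹ * (Q * (M p * a p) * e)) (fun p => C₁ * M p * (e⁻¹ * decay (t - x)))
      (fun β => by rw [le_inv_mul_iff₀ hW]; exact hφ β t) (fun β => hwin β t x)
    refine h1.trans ?_
    have h2 := sum_antidiagonal_choose_mul_pow_le hM hM1 (κ := 1) zero_le_one (∑ i, α i)
    have haα := ha0 (∑ i, α i)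
    calc _ ≤ ∑ ij ∈ Finset.HasAntidiagonal.antidiagonal (∑ i, α i),
          (W⁻¹ * C₁ * Q * a (∑ i, α i) * decay (t - x)) *
            (((∑ i, α i).choose ij.1 : ℝ) * (1 ^ ij.1 * M ij.1 * M ij.2)) := by
          refine Finset.sum_le_sum fun ij hij => ?_
          have h3 : a ij.1 ≤ a (∑ i, α i) :=
            ha (by rw [← Finset.HasAntidiagonal.mem_antidiagonal.1 hij]; omega)
          have h4 := hM ij.1
          have h5 := hM ij.2
          calc _ = (W⁻¹ * C₁ * Q * a ij.1 * decay (t - x)) *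
                (((∑ i, α i).choose ij.1 : ℝ) * (1 ^ ij.1 * M ij.1 * M ij.2)) := by
                rw [one_pow]; field_simp
            _ ≤ _ := by gcongr
      _ = (W⁻¹ * C₁ * Q * a (∑ i, α i) * decay (t - x)) * _ := (Finset.mul_sum _ _ _).symm
      _ ≤ (W⁻¹ * C₁ * Q * a (∑ i, α i) * decay (t - x)) *
          ((1 + 1) ^ (∑ i, α i) * (M 0 * M (∑ i, α i))) := by gcongr
      _ = _ := by norm_num; ring
  have hdecint : Integrable fun t => decay (t - x) := integrable_decay.comp_sub_right x
  have hint : ∀ α, Integrable (multiD α F).1 := fun α =>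
    (hdecint.const_mul _).mono' (continuous_multiD α F).aestronglyMeasurable
      (ae_of_all _ (hbound α))
  have hnorm : ∀ α ξ, W * ‖𝓕 (multiD α F).1 ξ‖ ≤ C₁ * M 0 * S * Q *
      (2 ^ (∑ i, α i) * (M (∑ i, α i) * a (∑ i, α i))) := by
    intro α ξ
    have h1 : ‖𝓕 (multiD α F).1 ξ‖ ≤ ∫ t, ‖(multiD α F).1 t‖ :=
      VectorFourier.norm_fourierIntegral_le_integral_norm _ _ _ _ _
    have h2 := integral_mono (hint α).norm (hdecint.const_mul _) (hbound α)
    rw [integral_const_mul, integral_sub_right_eq_self decay x] at h2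
    have h3 := mul_le_mul_of_nonneg_left (h1.trans h2) hW.le
    refine h3.trans_eq ?_
    rw [← hS]
    field_simp
  have hap : ∀ p, 0 ≤ M p * a p := fun p => mul_nonneg (hM p).le (ha0 p)
  refine ⟨hint, fun ξ p => ?_⟩
  have hC : C₁ * M 0 * S ≤ C₁ * M 0 * S + 1 := by linarith
  have hd1 : (1 : ℝ) ≤ (d : ℝ) + 1 := by
    have : (0 : ℝ) ≤ d := by positivity
    linarith
  rcases eq_or_ne ξ 0 with rfl | hξ
  · rcases p with _ | p
    · have h := hnorm 0 0
      simp only [multiD_zero, Module.End.one_apply, Pi.zero_apply, Finset.sum_const_zero,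
        pow_zero, one_mul] at h
      rw [pow_zero, pow_zero, mul_one, one_mul]
      refine h.trans ?_
      have := hap 0
      gcongr
    · have := hap (p + 1)
      simp only [norm_zero, ne_eq, Nat.add_eq_zero_iff, one_ne_zero, and_false,
        not_false_eq_true, zero_pow, mul_zero]
      positivity
  · obtain ⟨i, hi⟩ := exists_norm_le_mul_coord ξ hξ
    have h := hnorm (Pi.single i p) ξ
    rw [fourier_partialD_pow hint, norm_mul, norm_pow] at h
    simp only [Finset.sum_pi_single', Finset.mem_univ, if_true] at h
    -- The `2 ^ p` produced by the binomial sum is cancelled by the 2 in `2π|ξ_i|`.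
    have h2 : 2 * |ξ i| ≤ ‖2 * Real.pi * Complex.I * ξ i‖ := by
      simp only [norm_mul, Complex.norm_real, Complex.norm_I, Complex.norm_ofNat, mul_one,
        Real.norm_of_nonneg Real.pi_pos.le, Real.norm_eq_abs]
      have := Real.pi_gt_three
      gcongr
      linarith
    have hstft : stft χ φ (x, ξ) = 𝓕 F.1 ξ := rfl
    rw [hstft]
    have h3 : 2 ^ p * (W * ‖𝓕 F.1 ξ‖ * ‖ξ‖ ^ p) ≤
        2 ^ p * (C₁ * M 0 * S * Q * (((d : ℝ) + 1) ^ p * (M p * a p))) := by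
      calc 2 ^ p * (W * ‖𝓕 F.1 ξ‖ * ‖ξ‖ ^ p)
          ≤ 2 ^ p * (W * ‖𝓕 F.1 ξ‖ * (((d : ℝ) + 1) * |ξ i|) ^ p) := by gcongr
        _ = ((d : ℝ) + 1) ^ p * (W * ((2 * |ξ i|) ^ p * ‖𝓕 F.1 ξ‖)) := by
            simp only [mul_pow]; ring
        _ ≤ ((d : ℝ) + 1) ^ p *
            (W * (‖2 * Real.pi * Complex.I * ξ i‖ ^ p * ‖𝓕 F.1 ξ‖)) := by gcongr
        _ ≤ ((d : ℝ) + 1) ^ p * (C₁ * M 0 * S * Q * (2 ^ p * (M p * a p))) := by gcongr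
        _ = _ := by ring
    refine (le_of_mul_le_mul_left h3 (by positivity)).trans ?_
    have := hap p
    gcongr

end

section

variable {d : ℕ}

/-! ### Reconstruction -/

theorem integrable_of_moments {V : EuclideanSpace ℝ (Fin d) → ℂ} (hV : AEStronglyMeasurable V)
    {K : ℕ → ℝ} (h : ∀ ξ p, ‖V ξ‖ * ‖ξ‖ ^ p ≤ K p) : Integrable V := by
  refine (integrable_decay.const_mul (2 ^ (d + 1) * (K 0 + K (d + 1)))).mono' hV
    (ae_of_all _ fun ξ => ?_)
  rw [decay, ← div_eq_mul_inv, le_div_iff₀ (by positivity)]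
  calc ‖V ξ‖ * (1 + ‖ξ‖) ^ (d + 1) ≤ ‖V ξ‖ * (2 ^ (d + 1) * (1 + ‖ξ‖ ^ (d + 1))) := by
        gcongr; exact one_add_pow_le _ (norm_nonneg _)
    _ = 2 ^ (d + 1) * (‖V ξ‖ * ‖ξ‖ ^ 0 + ‖V ξ‖ * ‖ξ‖ ^ (d + 1)) := by ring
    _ ≤ _ := by
        have := add_le_add (h ξ 0) (h ξ (d + 1))
        gcongr

theorem integral_stft_mul_char {χ φ : smoothFunctions d} {x : EuclideanSpace ℝ (Fin d)}
    (hF : Integrable (smoothMul φ (smoothTranslate x χ)).1)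
    (hV : Integrable fun ξ => stft χ φ (x, ξ)) (t : EuclideanSpace ℝ (Fin d)) :
    ∫ ξ, stft χ φ (x, ξ) * (smoothChar ξ).1 t = φ.1 t * χ.1 (t - x) := by
  have h := congrFun ((smoothFunctions_contDiff
    (smoothMul φ (smoothTranslate x χ))).continuous.fourierInv_fourier_eq hF hV) t
  rw [Real.fourierInv_eq] at h
  refine Eq.trans ?_ h
  refine integral_congr_ae (ae_of_all _ fun ξ => ?_)
  exact mul_comm _ _

/-- By Fubini the frequency integral comes first and is Fourier inversion at `t`; the remaining
integral over `x` is translation invariant. -/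
theorem integral_stft_mul {χ φ ψ : smoothFunctions d}
    (hF : ∀ x, Integrable (smoothMul φ (smoothTranslate x χ)).1)
    (hV : ∀ x, Integrable fun ξ => stft χ φ (x, ξ)) (t : EuclideanSpace ℝ (Fin d))
    (hint : Integrable fun z : EuclideanSpace ℝ (Fin d) × EuclideanSpace ℝ (Fin d) =>
      stft χ φ z * (smoothMul (smoothChar z.2) (smoothTranslate z.1 ψ)).1 t) :
    ∫ z, stft χ φ z * (smoothMul (smoothChar z.2) (smoothTranslate z.1 ψ)).1 t =
      φ.1 t * ∫ y, χ.1 y * ψ.1 y := by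
  rw [Measure.volume_eq_prod] at hint ⊢
  rw [integral_prod _ hint]
  have h : ∀ x, ∫ ξ, stft χ φ (x, ξ) * (smoothMul (smoothChar ξ) (smoothTranslate x ψ)).1 t =
      φ.1 t * (χ.1 (t - x) * ψ.1 (t - x)) := by
    intro x
    rw [← mul_assoc, ← integral_stft_mul_char (hF x) (hV x) t, ← integral_mul_const]
    exact integral_congr_ae (ae_of_all _ fun ξ => (mul_assoc _ _ _).symm)
  simp only [h]
  rw [integral_const_mul, integral_sub_left_eq_self (fun y => χ.1 y * ψ.1 y)]

theorem IsWindow.integral_conj_mul_self_ne_zero {M A : ℕ → ℝ} (hA : IsWeightSequence A)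
    {ψ : smoothFunctions d} (hψ : IsWindow M A ψ) (h0 : ψ ≠ 0) :
    ∫ y, (smoothConj ψ).1 y * ψ.1 y ≠ 0 := by
  have hval : ∀ y, (smoothConj ψ).1 y * ψ.1 y = ((‖ψ.1 y‖ ^ 2 : ℝ) : ℂ) := fun y => by
    change (starRingEnd ℂ) (ψ.1 y) * ψ.1 y = _
    rw [Complex.conj_mul']
    push_cast
    rfl
  obtain ⟨C, hC, hb⟩ := hψ 1 one_pos
  have hcont : Continuous fun y => ‖ψ.1 y‖ ^ 2 :=
    (smoothFunctions_contDiff ψ).continuous.norm.pow 2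
  have hψb : ∀ y, ‖ψ.1 y‖ ≤ C * M 0 * decay y := fun y => by
    have h := hb 0 y
    simp only [multiD_zero, Module.End.one_apply, Pi.zero_apply, Finset.sum_const_zero,
      one_mul] at h
    rw [decay, ← div_eq_mul_inv, le_div_iff₀ (by positivity)]
    refine le_trans ?_ h
    have h1 := le_exp_assocFun hA (norm_nonneg y) 0
    rw [pow_zero, one_mul, div_self (hA.1 0).ne'] at h1
    gcongr
    exact le_mul_of_one_le_left (by positivity) h1
  have hdec1 : ∀ y : EuclideanSpace ℝ (Fin d), decay y ≤ 1 := fun y =>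
    inv_le_one_of_one_le₀ (one_le_pow₀ (by linarith [norm_nonneg y]))
  have hint : Integrable fun y => ‖ψ.1 y‖ ^ 2 := by
    refine (integrable_decay.const_mul ((C * M 0) ^ 2)).mono' hcont.aestronglyMeasurable
      (ae_of_all _ fun y => ?_)
    have hd := decay_pos y
    rw [Real.norm_of_nonneg (by positivity)]
    calc ‖ψ.1 y‖ ^ 2 ≤ (C * M 0 * decay y) ^ 2 := by gcongr; exact hψb y
      _ = (C * M 0) ^ 2 * (decay y * decay y) := by ring
      _ ≤ (C * M 0) ^ 2 * (decay y * 1) := by gcongr; exact hdec1 y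
      _ = _ := by rw [mul_one]
  obtain ⟨y₀, hy₀⟩ : ∃ y, ψ.1 y ≠ 0 := by
    by_contra! h
    exact h0 (Subtype.ext (funext h))
  have hpos : 0 < ∫ y, ‖ψ.1 y‖ ^ 2 := by
    rw [integral_pos_iff_support_of_nonneg (fun y => by positivity) hint]
    refine (IsOpen.measure_pos volume (isOpen_ne_fun hcont continuous_const)
      ⟨y₀, ?_⟩)
    simpa using hy₀
  simp only [hval]
  rw [integral_complex_ofReal]
  exact_mod_cast hpos.ne'

/-! ### The maximal Nachbin family -/

theorem iInf_mul_mem_nachbinFamily {X : Type*} [TopologicalSpace X] {v : ℕ → X → ℝ}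
    (hv : IsDecreasingWeightSystem v) {c : ℕ → ℝ} (hc : ∀ n, 0 ≤ c n) :
    (fun x => ⨅ n, c n * v n x) ∈ nachbinFamily v := by
  have hnn : ∀ x n, 0 ≤ c n * v n x := fun x n => mul_nonneg (hc n) (hv.2.1 n x).le
  have hbdd : ∀ x, BddBelow (Set.range fun n => c n * v n x) := fun x =>
    ⟨0, by rintro _ ⟨n, rfl⟩; exact hnn x n⟩
  refine ⟨fun x => Real.iInf_nonneg (hnn x), ?_, fun n => ⟨c n, ?_⟩⟩
  · exact upperSemicontinuous_ciInf hbdd fun n =>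
      ((hv.1 n).const_mul (c n)).upperSemicontinuous
  · rintro _ ⟨x, rfl⟩
    rw [div_le_iff₀ (hv.2.1 n x)]
    exact ciInf_le (hbdd x) n

theorem exists_le_mul_of_mem_nachbinFamily {X : Type*} [TopologicalSpace X] {v : ℕ → X → ℝ}
    (hv : IsDecreasingWeightSystem v) {u : X → ℝ} (hu : u ∈ nachbinFamily v) (n : ℕ) :
    ∃ K : ℝ, 0 ≤ K ∧ ∀ x, u x ≤ K * v n x := by
  obtain ⟨K, hK⟩ := hu.2.2 n
  refine ⟨|K|, abs_nonneg K, fun x => ?_⟩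
  rw [← div_le_iff₀ (hv.2.1 n x)]
  exact (hK ⟨x, rfl⟩).trans (le_abs_self K)

/-- Admissibility bounds `u x` by a constant times `v n t` and the exponential, for every `n`; the
infimum of these bounds over `n` is again a Nachbin weight. -/
theorem exists_nachbinFamily_translate {A : ℕ → ℝ} {v : ℕ → EuclideanSpace ℝ (Fin d) → ℝ}
    (hv : IsDecreasingWeightSystem v) {τ : ℝ}
    (hadm : ∀ n, ∃ m, ∃ C : ℝ, 0 < C ∧
      ∀ x t, v m x ≤ C * v n t * Real.exp (assocFun A (τ * ‖t - x‖)))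
    {u : EuclideanSpace ℝ (Fin d) → ℝ} (hu : u ∈ nachbinFamily v) :
    ∃ u' ∈ nachbinFamily v, ∀ x t, u x ≤ u' t * Real.exp (assocFun A (τ * ‖t - x‖)) := by
  choose m C hC hm using hadm
  choose K hK hKu using fun n => exists_le_mul_of_mem_nachbinFamily hv hu (m n)
  refine ⟨_, iInf_mul_mem_nachbinFamily hv (c := fun n => K n * C n)
    (fun n => mul_nonneg (hK n) (hC n).le), fun x t => ?_⟩
  rw [← div_le_iff₀ (Real.exp_pos _)]
  refine le_ciInf fun n => ?_
  rw [div_le_iff₀ (Real.exp_pos _)]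
  calc u x ≤ K n * v (m n) x := hKu n x
    _ ≤ K n * (C n * v n t * Real.exp (assocFun A (τ * ‖t - x‖))) := by
        have := hK n
        gcongr
        exact hm n x t
    _ = _ := by ring

/-! ### Equality of the two spaces -/

theorem isWeightSequence_prod {r : ℕ → ℝ} (hr : r ∈ komatsuFamily) :
    IsWeightSequence fun p => ∏ j ∈ Finset.range (p + 1), r j := by
  have hpos : ∀ p, 0 < ∏ j ∈ Finset.range (p + 1), r j := fun p =>
    Finset.prod_pos fun j _ => hr.1 j
  refine ⟨hpos, ?_⟩
  have h : (fun p => (∏ j ∈ Finset.range (p + 1 + 1), r j) / ∏ j ∈ Finset.range (p + 1), r j) =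
      fun p => r (p + 1) := by
    ext p
    rw [Finset.prod_range_succ _ (p + 1), mul_div_cancel_left₀ _ (hpos p).ne']
  rw [h]
  exact hr.2.2.comp (tendsto_add_atTop_nat 1)

theorem exists_projective_bound {M : ℕ → ℝ} (hM : ∀ p, 0 < M p)
    {v : ℕ → EuclideanSpace ℝ (Fin d) → ℝ} (hv : IsDecreasingWeightSystem v) {r : ℕ → ℝ}
    (hr : r ∈ komatsuFamily) {u : EuclideanSpace ℝ (Fin d) → ℝ} (hu : u ∈ nachbinFamily v)
    (n : ℕ) : ∃ C : ℝ, 0 ≤ C ∧ ∀ (φ : smoothFunctions d) (K : ℝ), 0 ≤ K →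
      (∀ α x, stepCoeff M (1 / ((n : ℝ) + 1)) (∑ i, α i) * ‖(multiD α φ).1 x‖ * v n x ≤ K) →
      ∀ α x, komatsuCoeff M r (∑ i, α i) * ‖(multiD α φ).1 x‖ * u x ≤ C * K := by
  obtain ⟨C₁, hC₁, h₁⟩ := (isWeightSequence_prod hr).exists_bound ((n : ℝ) + 1)
  obtain ⟨C₂, hC₂, h₂⟩ := exists_le_mul_of_mem_nachbinFamily hv hu n
  refine ⟨C₁ * C₂, by positivity, fun φ K hK h α x => ?_⟩
  have h3 := h α x
  have h4 := h₁ ((n : ℝ) + 1) (by positivity) le_rfl (∑ i, α i)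
  have hMp := hM (∑ i, α i)
  have hR := (isWeightSequence_prod hr).1 (∑ i, α i)
  have hvn := hv.2.1 n x
  simp only [stepCoeff, komatsuCoeff] at h3 ⊢
  set R := ∏ j ∈ Finset.range (∑ i, α i + 1), r j with hRdef
  calc 1 / (M (∑ i, α i) * R) * ‖(multiD α φ).1 x‖ * u x
      ≤ 1 / (M (∑ i, α i) * R) * ‖(multiD α φ).1 x‖ * (C₂ * v n x) := by
        gcongr
        exact h₂ x
    _ = (((n : ℝ) + 1) ^ (∑ i, α i) / R) * C₂ *
        ((1 / ((n : ℝ) + 1)) ^ (∑ i, α i) / M (∑ i, α i) * ‖(multiD α φ).1 x‖ * v n x) := by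
        rw [div_pow, one_pow]; field_simp
    _ ≤ C₁ * C₂ * K := by gcongr

theorem roumieuSpace_le_projectiveSpace {M : ℕ → ℝ} (hM : IsWeightSequence M)
    {v : ℕ → EuclideanSpace ℝ (Fin d) → ℝ} (hv : IsDecreasingWeightSystem v) :
    roumieuSpace M v ≤ projectiveSpace M v := by
  intro φ hφ
  obtain ⟨n, hn⟩ := (mem_roumieuSpace_iff hM hv φ).1 hφ
  obtain ⟨K, hK, h⟩ := mem_weightedSpace_iff.1 hn
  refine (Submodule.mem_iInf _).2 fun i => ?_
  obtain ⟨C, hC, hb⟩ := exists_projective_bound hM.1 hv i.1.2 i.2.2 n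
  exact mem_weightedSpace_iff.2 ⟨C * K, by positivity, hb φ K hK h⟩

theorem projectiveSpace_le_roumieuSpace {M : ℕ → ℝ} (hM : IsWeightSequence M)
    {v : ℕ → EuclideanSpace ℝ (Fin d) → ℝ} (hv : IsDecreasingWeightSystem v) :
    projectiveSpace M v ≤ roumieuSpace M v := by
  intro φ hφ
  rw [mem_roumieuSpace_iff hM hv]
  by_contra! hcon
  -- Of the two factors `n + 1`, one pays for the entry `r 0` of the product and the other exceeds
  -- the assumed bound `K`.
  have hex : ∀ n : ℕ, ∃ α x, ((n : ℝ) + 1) ^ 2 <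
      stepCoeff M (1 / ((n : ℝ) + 1)) (∑ i, α i) * ‖(multiD α φ).1 x‖ * v n x := by
    intro n
    by_contra! h
    exact hcon n (mem_weightedSpace_iff.2 ⟨_, by positivity, h⟩)
  choose α x hαx using hex
  obtain ⟨r, hr, hr1, hrle⟩ := exists_komatsu_le fun n => ∑ i, α n i
  have hvanti : ∀ x, Antitone fun k => v k x := fun x => antitone_nat_of_succ_le fun k => hv.2.2 k x
  have hq : ∀ n k, 0 ≤ v n (x n) / v k (x n) := fun n k =>
    div_nonneg (hv.2.1 _ _).le (hv.2.1 _ _).le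
  -- The sum forces `c k * v k (x n) ≥ v n (x n)` when `n < k`; for `k ≤ n` monotonicity and `c k ≥
  -- 1` suffice. Hence the infimum is at least `v n` at `x n`.
  set c : ℕ → ℝ := fun k => 1 + ∑ n ∈ Finset.range k, v n (x n) / v k (x n) with hc
  have hc1 : ∀ k, 1 ≤ c k := fun k => by
    have := Finset.sum_nonneg fun n (_ : n ∈ Finset.range k) => hq n k
    simp only [hc]; linarith
  have hu := iInf_mul_mem_nachbinFamily hv (c := c) fun k => zero_le_one.trans (hc1 k)
  have hux : ∀ n, v n (x n) ≤ ⨅ k, c k * v k (x n) := by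
    intro n
    refine le_ciInf fun k => ?_
    have hvk := hv.2.1 k (x n)
    rcases le_or_gt k n with hkn | hkn
    · exact (hvanti (x n) hkn).trans (le_mul_of_one_le_left hvk.le (hc1 k))
    · rw [← div_le_iff₀ hvk]
      have := Finset.single_le_sum (f := fun n => v n (x n) / v k (x n)) (fun n _ => hq n k)
        (Finset.mem_range.2 hkn)
      simp only [hc]
      linarith
  obtain ⟨K, hK, hb⟩ := mem_weightedSpace_iff.1 (projectiveSpace_le M v (⟨r, hr⟩, ⟨_, hu⟩) hφ)
  obtain ⟨n, hn⟩ := exists_nat_ge K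
  have h1 := hb (α n) (x n)
  have h2 := hαx n
  simp only [komatsuCoeff, stepCoeff] at h1 h2
  set p := ∑ i, α n i with hp
  have hMp := hM.1 p
  have hR0 := (isWeightSequence_prod hr).1 p
  set R := ∏ j ∈ Finset.range (p + 1), r j with hRdef
  have hR : R ≤ ((n : ℝ) + 1) ^ (p + 1) := by
    refine (prod_range_succ_le_pow hr.1 fun j _ hj => hrle n j hj).trans ?_
    rw [pow_succ']
    gcongr
    exact hrle n 0 (Nat.zero_le _)
  have hvn := hv.2.1 n (x n)
  have h3 : ‖(multiD (α n) φ).1 (x n)‖ * v n (x n) ≤ K * (M p * R) := by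
    rw [one_div, mul_assoc, inv_mul_le_iff₀ (by positivity)] at h1
    refine le_trans ?_ (h1.trans_eq (by ring))
    gcongr
    exact hux n
  have h4 : ((n : ℝ) + 1) ^ (p + 2) * M p < ‖(multiD (α n) φ).1 (x n)‖ * v n (x n) := by
    rw [div_pow, one_pow, div_div, one_div, mul_assoc, lt_inv_mul_iff₀ (by positivity)] at h2
    calc _ = ((n : ℝ) + 1) ^ p * M p * ((n : ℝ) + 1) ^ 2 := by ring
      _ < _ := h2
  have h5 : K * (M p * R) ≤ ((n : ℝ) + 1) * (M p * ((n : ℝ) + 1) ^ (p + 1)) := by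
    gcongr
    linarith
  have h6 : ((n : ℝ) + 1) * (M p * ((n : ℝ) + 1) ^ (p + 1)) = ((n : ℝ) + 1) ^ (p + 2) * M p := by
    ring
  linarith

theorem roumieuSpace_eq_projectiveSpace {M : ℕ → ℝ} (hM : IsWeightSequence M)
    {v : ℕ → EuclideanSpace ℝ (Fin d) → ℝ} (hv : IsDecreasingWeightSystem v) :
    roumieuSpace M v = projectiveSpace M v :=
  le_antisymm (roumieuSpace_le_projectiveSpace hM hv) (projectiveSpace_le_roumieuSpace hM hv)

end

section

variable {d : ℕ}

/-! ### Decomposition -/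

theorem exists_sum_indicator_eq {Z : Type*} [MeasurableSpace Z] (V : Z → ℂ) {S : ℕ → Set Z}
    (hS : ∀ k, MeasurableSet (S k)) {N : ℕ} (hcov : ∀ z, ∃ k ≤ N, z ∈ S k) :
    ∃ S' : ℕ → Set Z, (∀ k, MeasurableSet (S' k)) ∧ (∀ k, S' k ⊆ S k) ∧
      ∀ z, ∑ k ∈ Finset.range (N + 1), (S' k).indicator V z = V z := by
  refine ⟨fun k => S k ∩ ⋂ j, ⋂ (_ : j < k), (S j)ᶜ, fun k => (hS k).inter
    (MeasurableSet.iInter fun j => MeasurableSet.iInter fun _ => (hS j).compl),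
    fun k => Set.inter_subset_left, fun z => ?_⟩
  classical
  have hex : ∃ k, z ∈ S k := let ⟨k, _, h⟩ := hcov z; ⟨k, h⟩
  have hle : Nat.find hex ≤ N := let ⟨k, hk, h⟩ := hcov z; (Nat.find_min' hex h).trans hk
  rw [Finset.sum_eq_single (Nat.find hex)]
  · have hz : z ∈ S (Nat.find hex) ∩ ⋂ j, ⋂ (_ : j < Nat.find hex), (S j)ᶜ := by
      refine ⟨Nat.find_spec hex, ?_⟩
      simp only [Set.mem_iInter, Set.mem_compl_iff]
      exact fun j hj => Nat.find_min hex hj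
    exact Set.indicator_of_mem hz V
  · intro k _ hk
    refine Set.indicator_of_notMem (fun hz => ?_) V
    have h1 : Nat.find hex ≤ k := Nat.find_min' hex hz.1
    have h2 := hz.2
    simp only [Set.mem_iInter, Set.mem_compl_iff] at h2
    exact h2 _ (lt_of_le_of_ne h1 (Ne.symm hk)) (Nat.find_spec hex)
  · intro h
    exact absurd (Finset.mem_range.2 (by omega)) h

theorem exists_decomposition {M A : ℕ → ℝ} (hM : IsWeightSequence M) (hM1 : ConditionM1 M)
    (hM2 : ConditionM2' M) (hA : IsWeightSequence A) {ψ : smoothFunctions d}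
    (hψ : IsWindow M A ψ) (hψ0 : ψ ≠ 0) {v : ℕ → EuclideanSpace ℝ (Fin d) → ℝ}
    (hv : IsDecreasingWeightSystem v) (hadm : IsAdmissible A v) (hV : ConditionV v)
    {ε : ℕ → ℝ} (hε : ∀ n, 0 < ε n) :
    ∃ r ∈ komatsuFamily, ∃ u ∈ nachbinFamily v, ∃ κ : ℕ → ℕ, ∀ φ ∈ roumieuSpace M v,
      (∀ α x, komatsuCoeff M r (∑ i, α i) * ‖(multiD α φ).1 x‖ * u x ≤ 1) →
      ∃ (N : ℕ) (f : ℕ → smoothFunctions d),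
        (∀ k α x, stepCoeff M (1 / ((κ k : ℝ) + 1)) (∑ i, α i) * ‖(multiD α (f k)).1 x‖ *
          v (κ k) x ≤ ε (κ k)) ∧
        ∀ x, φ.1 x = ∑ k ∈ Finset.range (N + 1), ((1 / 2 : ℝ) ^ (k + 1) : ℝ) * (f k).1 x := by
  set χ := smoothConj ψ with hχdef
  have hχ : IsWindow M A χ := hψ.conj
  set c₀ : ℂ := ∫ y, χ.1 y * ψ.1 y with hc₀
  have hc₀0 : c₀ ≠ 0 := hψ.integral_conj_mul_self_ne_zero hA hψ0
  have hc₀n : 0 < ‖c₀‖ := norm_pos_iff.2 hc₀0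
  choose κ C hC hsyn using exists_synthesis hM hM1 hM2 hv hadm hψ
  obtain ⟨τ, hτ, hadm⟩ := hadm
  have hadm' : ∀ n, ∃ m, ∃ C : ℝ, 0 < C ∧
      ∀ x t, v m x ≤ C * v n t * Real.exp (assocFun A (τ * ‖t - x‖)) := by
    intro n
    obtain ⟨m, -, C, hC, h⟩ := hadm n
    refine ⟨m, C, hC, fun x t => ?_⟩
    have := h t (x - t)
    rwa [add_sub_cancel, norm_smul, Real.norm_of_nonneg hτ.le, norm_sub_rev] at this
  obtain ⟨Ca, hCa, hstft⟩ := exists_stft_bound hM.1 hM1 hχ hτ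
  -- The size allowed for the `k`-th piece: after the synthesis constant `C k`, division by `c₀` and
  -- the factor `2 ^ (k + 1)`, exactly `ε (κ k)` remains.
  set b : ℕ → ℝ := fun k => ε (κ k) * ‖c₀‖ * (1 / 2) ^ (k + 1) / C k with hb
  have hb0 : ∀ k, 0 < b k := fun k => by
    have := hε (κ k)
    have := hC k
    simp only [hb]; positivity
  obtain ⟨u₀, hu₀, r, hr, hr1, hphase⟩ := exists_phase_space_weights hM hv hV
    (fun k => (b k)⁻¹) (c := (d : ℝ) + 1) (C := Ca) (by positivity) hCa
  obtain ⟨u, hu, huu₀⟩ := exists_nachbinFamily_translate hv hadm' hu₀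
  refine ⟨r, hr, u, hu, κ, fun φ hφ hφu => ?_⟩
  have hvanti : ∀ x, Antitone fun k => v k x := fun x => antitone_nat_of_succ_le fun k => hv.2.2 k x
  have hexp : ∀ x t : EuclideanSpace ℝ (Fin d), 0 < Real.exp (assocFun A (τ * ‖t - x‖)) :=
    fun _ _ => Real.exp_pos _
  -- the bound coming from the seminorm
  have hu₀b : ∀ x ξ p, ‖stft χ φ (x, ξ)‖ * u₀ x * ‖ξ‖ ^ p ≤
      Ca * (((d : ℝ) + 1) ^ p * (M p * ∏ j ∈ Finset.range (p + 1), r j)) := by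
    intro x ξ p
    have hR := (isWeightSequence_prod hr).1
    -- Nachbin weights may vanish, whereas the transform estimate requires a positive weight.
    rcases (hu₀.1 x).eq_or_lt with h0 | hpos
    · rw [← h0, mul_zero, zero_mul]
      have := hM.1 p
      have := hR p
      positivity
    · have h := (hstft φ x (u₀ x) 1 (fun p => ∏ j ∈ Finset.range (p + 1), r j) hpos zero_le_one
        (monotone_prod_range_succ hr.1 hr1) (fun p => (hR p).le) fun α t => ?_).2 ξ p
      · rw [mul_one] at h
        linarith
      · have h1 := hφu α t
        have hMR := mul_pos (hM.1 (∑ i, α i)) (hR (∑ i, α i))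
        simp only [komatsuCoeff] at h1
        rw [one_div, mul_assoc, inv_mul_le_iff₀ hMR, mul_one] at h1
        calc u₀ x * ‖(multiD α φ).1 t‖
            ≤ u t * Real.exp (assocFun A (τ * ‖t - x‖)) * ‖(multiD α φ).1 t‖ := by
              gcongr; exact huu₀ x t
          _ = (‖(multiD α φ).1 t‖ * u t) * Real.exp (assocFun A (τ * ‖t - x‖)) := by ring
          _ ≤ _ := by rw [one_mul]; gcongr
  -- the qualitative bound coming from membership in a step
  obtain ⟨n, hn⟩ := (mem_roumieuSpace_iff hM hv φ).1 hφ
  obtain ⟨K, hK, hKb⟩ := mem_weightedSpace_iff.1 hn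
  obtain ⟨m, C', hC', hm⟩ := hadm' n
  have hstep := fun x => hstft φ x (v m x) (C' * K) (fun p => ((n : ℝ) + 1) ^ p) (hv.2.1 m x)
    (by positivity) (fun p q hpq => pow_le_pow_right₀ (by
      have : (0 : ℝ) ≤ n := by positivity
      linarith) hpq) (fun p => by positivity) fun α t => by
      have h1 := hKb α t
      have hMp := hM.1 (∑ i, α i)
      simp only [stepCoeff] at h1
      rw [div_pow, one_pow, div_div, one_div, mul_assoc, inv_mul_le_iff₀ (by positivity)] at h1
      calc v m x * ‖(multiD α φ).1 t‖
          ≤ C' * v n t * Real.exp (assocFun A (τ * ‖t - x‖)) * ‖(multiD α φ).1 t‖ := by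
            gcongr; exact hm x t
        _ = C' * (‖(multiD α φ).1 t‖ * v n t) * Real.exp (assocFun A (τ * ‖t - x‖)) := by ring
        _ ≤ C' * (((n : ℝ) + 1) ^ (∑ i, α i) * M (∑ i, α i) * K) *
            Real.exp (assocFun A (τ * ‖t - x‖)) := by gcongr
        _ = _ := by ring
  have hF : ∀ x, Integrable (smoothMul φ (smoothTranslate x χ)).1 := fun x => by
    simpa [multiD_zero] using (hstep x).1 0
  have hVint : ∀ x, Integrable fun ξ => stft χ φ (x, ξ) := fun x => by
    have hvm := hv.2.1 m x
    refine integrable_of_moments (K := fun p => (v m x)⁻¹ *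
      (Ca * (C' * K) * (((d : ℝ) + 1) ^ p * (M p * ((n : ℝ) + 1) ^ p))))
      ((stronglyMeasurable_stft χ φ).comp_measurable measurable_prodMk_left).aestronglyMeasurable
      fun ξ p => ?_
    rw [le_inv_mul_iff₀ hvm, ← mul_assoc]
    exact (hstep x).2 ξ p
  -- One index must serve both the weight `v m` and the frequency factor `(d + 1)(n + 1)`. The
  -- resulting `N` depends on `φ` through `n` and `K`.
  set n' := max m ((d + 1) * (n + 1)) with hn'
  obtain ⟨N, hN⟩ := hphase n' (Ca * (C' * K))
  have hcov : ∀ z : EuclideanSpace ℝ (Fin d) × EuclideanSpace ℝ (Fin d), ∃ k ≤ N, ∀ p,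
      (b k)⁻¹ * (‖stft χ φ z‖ * v k z.1 * ‖z.2‖ ^ p) ≤ ((k : ℝ) + 1) ^ p * M p := by
    rintro ⟨x, ξ⟩
    refine hN x ‖ξ‖ ‖stft χ φ (x, ξ)‖ (norm_nonneg _) (norm_nonneg _) (fun p => ?_)
      (hu₀b x ξ)
    have hMp := hM.1 p
    have h1 : ((d : ℝ) + 1) * ((n : ℝ) + 1) ≤ (n' : ℝ) + 1 := by
      have : (((d + 1) * (n + 1) : ℕ) : ℝ) ≤ n' := by exact_mod_cast le_max_right _ _
      push_cast at this
      linarith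
    calc ‖stft χ φ (x, ξ)‖ * v n' x * ‖ξ‖ ^ p ≤ ‖stft χ φ (x, ξ)‖ * v m x * ‖ξ‖ ^ p := by
          gcongr
          exact hvanti x (le_max_left _ _)
      _ = v m x * ‖stft χ φ (x, ξ)‖ * ‖ξ‖ ^ p := by ring
      _ ≤ Ca * (C' * K) * (((d : ℝ) + 1) ^ p * (M p * ((n : ℝ) + 1) ^ p)) := (hstep x).2 ξ p
      _ = Ca * (C' * K) * (((d : ℝ) + 1) * ((n : ℝ) + 1)) ^ p * M p := by rw [mul_pow]; ring
      _ ≤ _ := by gcongr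
  have hVmeas := stronglyMeasurable_stft χ φ
  obtain ⟨S', hS'm, hS'S, hS'⟩ := exists_sum_indicator_eq (stft χ φ)
    (S := fun k => {z : EuclideanSpace ℝ (Fin d) × EuclideanSpace ℝ (Fin d) | ∀ p,
      (b k)⁻¹ * (‖stft χ φ z‖ * v k z.1 * ‖z.2‖ ^ p) ≤ ((k : ℝ) + 1) ^ p * M p})
    (fun k => by
      rw [Set.ofPred_forall]
      refine MeasurableSet.iInter fun p => measurableSet_le ?_ measurable_const
      have h1 := hVmeas.norm.measurable
      have h2 : Measurable fun z : EuclideanSpace ℝ (Fin d) × EuclideanSpace ℝ (Fin d) =>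
        v k z.1 := ((hv.1 k).comp continuous_fst).measurable
      have h3 : Measurable fun z : EuclideanSpace ℝ (Fin d) × EuclideanSpace ℝ (Fin d) =>
        ‖z.2‖ ^ p := (continuous_snd.norm.pow p).measurable
      exact ((h1.mul h2).mul h3).const_mul _) hcov
  have hG : ∀ k z p, ‖(S' k).indicator (stft χ φ) z‖ * v k z.1 * ‖z.2‖ ^ p ≤
      b k * (((k : ℝ) + 1) ^ p * M p) := by
    intro k z p
    by_cases hz : z ∈ S' k
    · rw [Set.indicator_of_mem hz]
      have h := hS'S k hz p
      rwa [inv_mul_le_iff₀ (hb0 k)] at h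
    · rw [Set.indicator_of_notMem hz, norm_zero, zero_mul, zero_mul]
      have := hM.1 p
      have := hb0 k
      positivity
  choose g hg hgb using fun k => hsyn k ((S' k).indicator (stft χ φ)) (b k) (hb0 k).le
    (hVmeas.indicator (hS'm k)) (hG k)
  refine ⟨N, fun k => ((2 : ℂ) ^ (k + 1) / c₀) • g k, fun k α x => ?_, fun x => ?_⟩
  · rw [smoothMul_smul_left_multiD, norm_mul]
    have hMp := hM.1 (∑ i, α i)
    have hCk := hC k
    have h2 : ‖(2 : ℂ) ^ (k + 1) / c₀‖ = 2 ^ (k + 1) / ‖c₀‖ := by simp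
    rw [h2]
    simp only [stepCoeff]
    calc _ = (2 ^ (k + 1) / ‖c₀‖) * (1 / (((κ k : ℝ) + 1) ^ (∑ i, α i) * M (∑ i, α i))) *
          (‖(multiD α (g k)).1 x‖ * v (κ k) x) := by
          rw [div_pow, one_pow, div_div]; ring
      _ ≤ (2 ^ (k + 1) / ‖c₀‖) * (1 / (((κ k : ℝ) + 1) ^ (∑ i, α i) * M (∑ i, α i))) *
          (C k * b k * (((κ k : ℝ) + 1) ^ (∑ i, α i) * M (∑ i, α i))) :=
          mul_le_mul_of_nonneg_left (hgb k α x) (by positivity)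
      _ = ε (κ k) := by
          simp only [hb, div_pow, one_pow]
          field_simp
  · have hsum : ∀ z : EuclideanSpace ℝ (Fin d) × EuclideanSpace ℝ (Fin d),
        ∑ k ∈ Finset.range (N + 1), (S' k).indicator (stft χ φ) z *
          (smoothMul (smoothChar z.2) (smoothTranslate z.1 ψ)).1 x =
        stft χ φ z * (smoothMul (smoothChar z.2) (smoothTranslate z.1 ψ)).1 x := by
      intro z
      rw [← Finset.sum_mul, hS' z]
    have hint := integrable_finsetSum (Finset.range (N + 1)) fun k _ => (hg k x).1
    simp only [hsum] at hint
    have hrec := integral_stft_mul hF hVint x hint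
    rw [← hc₀] at hrec
    have hsumint : ∑ k ∈ Finset.range (N + 1), (g k).1 x = φ.1 x * c₀ := by
      rw [← hrec]
      simp only [← hsum]
      rw [integral_finsetSum _ fun k _ => (hg k x).1]
      exact Finset.sum_congr rfl fun k _ => (hg k x).2
    have hterm : ∀ k, (((1 / 2 : ℝ) ^ (k + 1) : ℝ) : ℂ) *
        (((2 : ℂ) ^ (k + 1) / c₀) • g k : smoothFunctions d).1 x = (g k).1 x / c₀ := by
      intro k
      change _ * ((2 : ℂ) ^ (k + 1) / c₀ * (g k).1 x) = _
      push_cast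
      rw [div_pow, one_pow]
      field_simp
    simp only [hterm]
    rw [← Finset.sum_div, hsumint, mul_div_cancel_right₀ _ hc₀0]

end

section

variable {d : ℕ}

/-! ### Comparison of the topologies -/

/-! ### Topologies generated by seminorms -/

section

variable {E F G ι : Type*} [AddCommGroup E] [Module ℂ E] [AddCommGroup F] [Module ℂ F]
  [AddCommGroup G] [Module ℂ G]

theorem withSeminorms_seminormTopology (p : Seminorm ℂ E) :
    WithSeminorms (topology := seminormTopology p) fun _ : Unit => p := by
  let _ := seminormTopology p
  have : IsTopologicalAddGroup E := p.toSeminormedAddCommGroup.toIsTopologicalAddGroup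
  rw [SeminormFamily.withSeminorms_iff_topologicalSpace_eq_iInf, iInf_const]

theorem withSeminorms_iInf_seminormTopology (p : ι → Seminorm ℂ E) :
    WithSeminorms (topology := ⨅ i, seminormTopology (p i)) p := by
  let _ : TopologicalSpace E := ⨅ i, seminormTopology (p i)
  have : IsTopologicalAddGroup E := topologicalAddGroup_iInf fun i =>
    (p i).toSeminormedAddCommGroup.toIsTopologicalAddGroup
  exact (SeminormFamily.withSeminorms_iff_topologicalSpace_eq_iInf p).2 rfl

theorem withSeminorms_induced_iInf_seminormTopology (p : ι → Seminorm ℂ F) (e : E ≃ₗ[ℂ] F) :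
    WithSeminorms (topology := (⨅ i, seminormTopology (p i)).induced e)
      fun i => (p i).comp e.toLinearMap := by
  let _ : TopologicalSpace F := ⨅ i, seminormTopology (p i)
  exact e.toLinearMap.withSeminorms_induced (withSeminorms_iInf_seminormTopology p)

theorem continuous_induced_iInf_seminormTopology (q : Seminorm ℂ G) (p : ι → Seminorm ℂ F)
    (e : E ≃ₗ[ℂ] F) (f : G →ₗ[ℂ] E)
    (hb : ∀ i, ∃ C : ℝ, 0 ≤ C ∧ ∀ x, p i (e (f x)) ≤ C * q x) :
    @Continuous _ _ (seminormTopology q) ((⨅ i, seminormTopology (p i)).induced e) f := by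
  let _ := seminormTopology q
  let _ : TopologicalSpace E := (⨅ i, seminormTopology (p i)).induced e
  refine WithSeminorms.continuous_of_isBounded (withSeminorms_seminormTopology q)
    (withSeminorms_induced_iInf_seminormTopology p e) f fun i => ?_
  obtain ⟨C, hC, h⟩ := hb i
  refine ⟨{()}, ⟨C, hC⟩, fun x => ?_⟩
  rw [Finset.sup_singleton]
  exact h x

theorem exists_seminorm_ball_subset_preimage (q : Seminorm ℂ G) (f : G →ₗ[ℂ] E)
    {t : TopologicalSpace E} (hf : @Continuous _ _ (seminormTopology q) t f) {U : Set E}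
    (hU : U ∈ 𝓝 (0 : E)) : ∃ ε : ℝ, 0 < ε ∧ ∀ x, q x ≤ ε → f x ∈ U := by
  let _ := seminormTopology q
  have h1 : f ⁻¹' U ∈ 𝓝 (0 : G) := by
    refine hf.continuousAt ?_
    rw [map_zero]
    exact hU
  obtain ⟨s, ε, hε, hsub⟩ := ((withSeminorms_seminormTopology q).mem_nhds_iff 0 _).1 h1
  refine ⟨ε / 2, half_pos hε, fun x hx => hsub ?_⟩
  rw [Seminorm.mem_ball_zero]
  exact lt_of_le_of_lt (Seminorm.finset_sup_apply_le (half_pos hε).le fun _ _ => hx)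
    (half_lt_self hε)

/-- Local convexity reduces the comparison to convex neighbourhoods of zero, and containing the unit
ball of one seminorm of the family is enough. -/
theorem induced_iInf_seminormTopology_le [Module ℝ E] (p : ι → Seminorm ℂ F) (e : E ≃ₗ[ℂ] F)
    {t : TopologicalSpace E} [IsTopologicalAddGroup E] [LocallyConvexSpace ℝ E]
    (h : ∀ U ∈ 𝓝 (0 : E), Convex ℝ U → ∃ i, ∀ x, p i (e x) ≤ 1 → x ∈ U) :
    (⨅ i, seminormTopology (p i)).induced e ≤ t := by
  have hs := withSeminorms_induced_iInf_seminormTopology p e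
  rw [← continuous_id_iff_le]
  refine @continuous_of_continuousAt_zero E ((⨅ i, seminormTopology (p i)).induced e) _
    (@WithSeminorms.topologicalAddGroup _ _ _ _ _ _ (_) _ hs) E (E →+ E) _ t _ _ _ (AddMonoidHom.id E) fun U hU => ?_
  obtain ⟨U', ⟨hU', hUc⟩, hsub⟩ := (LocallyConvexSpace.convex_basis_zero ℝ E).mem_iff.1 hU
  obtain ⟨i, hi⟩ := h U' hU' hUc
  let _ : TopologicalSpace E := (⨅ i, seminormTopology (p i)).induced e
  have hc : Continuous fun x => p i (e x) := hs.continuous_seminorm i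
  filter_upwards [hc.continuousAt.eventually_lt continuousAt_const
    (by rw [map_zero, map_zero]; exact one_pos)] with x hx
  exact hsub (hi x hx.le)

end

/-! ### The inductive limit and projective topologies -/

variable {M : ℕ → ℝ} {v : ℕ → EuclideanSpace ℝ (Fin d) → ℝ}

theorem projectiveSeminorm_le_iff {i : komatsuFamily × nachbinFamily v}
    {φ : projectiveSpace M v} {K : ℝ} (hK : 0 ≤ K) :
    projectiveSeminorm M v i φ ≤ K ↔
      ∀ α x, komatsuCoeff M i.1.1 (∑ j, α j) * ‖(multiD α φ.1).1 x‖ * i.2.1 x ≤ K := by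
  rw [projectiveSeminorm, Seminorm.comp_apply, weightedSeminorm_le_iff hK,
    Submodule.coe_inclusion]

theorem coe_ofEq_roumieuIncl (h : roumieuSpace M v = projectiveSpace M v) (n : ℕ)
    (φ : roumieuStep M v n) :
    (LinearEquiv.ofEq _ _ h (roumieuIncl M v n φ)).1 = φ.1 := by
  rw [LinearEquiv.coe_ofEq_apply]
  rfl

theorem continuous_roumieuIncl (hM : ∀ p, 0 < M p) (hv : IsDecreasingWeightSystem v)
    (h : roumieuSpace M v = projectiveSpace M v) (n : ℕ) :
    @Continuous _ _ (roumieuStepTopology M v n)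
      ((projectiveTopology M v).induced (LinearEquiv.ofEq _ _ h)) (roumieuIncl M v n) := by
  refine continuous_induced_iInf_seminormTopology (E := roumieuSpace M v)
    (F := projectiveSpace M v) (G := roumieuStep M v n)
    (weightedSeminorm (stepCoeff M (1 / ((n : ℝ) + 1))) (v n)) (projectiveSeminorm M v)
    (LinearEquiv.ofEq _ _ h) (roumieuIncl M v n) fun i => ?_
  obtain ⟨C, hC, hb⟩ := exists_projective_bound hM hv i.1.2 i.2.2 n
  refine ⟨C, hC, fun φ => ?_⟩
  rw [projectiveSeminorm_le_iff (mul_nonneg hC (apply_nonneg _ _)), coe_ofEq_roumieuIncl]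
  exact hb φ.1 _ (apply_nonneg _ _) ((weightedSeminorm_le_iff (apply_nonneg _ _)).1 le_rfl)

theorem roumieuTopology_le (hM : ∀ p, 0 < M p) (hv : IsDecreasingWeightSystem v)
    (h : roumieuSpace M v = projectiveSpace M v) :
    roumieuTopology M v ≤ (projectiveTopology M v).induced (LinearEquiv.ofEq _ _ h) := by
  have hs := withSeminorms_induced_iInf_seminormTopology (E := roumieuSpace M v)
    (F := projectiveSpace M v) (projectiveSeminorm M v) (LinearEquiv.ofEq _ _ h)
  exact sInf_le ⟨@WithSeminorms.topologicalAddGroup _ _ _ _ _ _ (_) _ hs,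
    @WithSeminorms.continuousSMul _ _ _ _ _ _ (_) _ hs,
    @WithSeminorms.toLocallyConvexSpace ℂ _ _ _ _ _ _ _ _ (_) _ hs,
    continuous_roumieuIncl hM hv h⟩

theorem sum_range_half_pow_succ (n : ℕ) :
    ∑ k ∈ Finset.range n, (1 / 2 : ℝ) ^ (k + 1) = 1 - (1 / 2) ^ n := by
  induction n with
  | zero => simp
  | succ n ih => rw [Finset.sum_range_succ, ih]; ring

theorem sum_half_pow_smul_mem {E : Type*} [AddCommGroup E] [Module ℝ E] {U : Set E}
    (hU : Convex ℝ U) (h0 : (0 : E) ∈ U) {f : ℕ → E} (hf : ∀ k, f k ∈ U) (N : ℕ) :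
    ∑ k ∈ Finset.range N, ((1 / 2 : ℝ) ^ (k + 1)) • f k ∈ U := by
  -- The missing mass `2^{-N}` is placed at the origin to obtain a genuine convex combination.
  have h1 := hU.sum_mem (t := Finset.range (N + 1))
    (w := fun k => if k = N then (1 / 2 : ℝ) ^ N else (1 / 2) ^ (k + 1))
    (z := fun k => if k = N then 0 else f k)
    (fun k _ => by split_ifs <;> positivity) ?_ (fun k _ => by
      split_ifs
      exacts [h0, hf k])
  · rw [Finset.sum_range_succ, if_pos rfl, if_pos rfl, smul_zero, add_zero] at h1
    convert h1 using 1
    refine Finset.sum_congr rfl fun k hk => ?_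
    have : k ≠ N := (Finset.mem_range.1 hk).ne
    rw [if_neg this, if_neg this]
  · rw [Finset.sum_range_succ, if_pos rfl, Finset.sum_congr rfl fun k hk =>
      if_neg (Finset.mem_range.1 hk).ne, sum_range_half_pow_succ]
    ring

theorem le_roumieuTopology {A : ℕ → ℝ} (hM : IsWeightSequence M) (hM1 : ConditionM1 M)
    (hM2 : ConditionM2' M) (hA : IsWeightSequence A) (hA2 : ConditionM2' A)
    (hS : beurlingSpace d M A ≠ ⊥) (hv : IsDecreasingWeightSystem v) (hadm : IsAdmissible A v)
    (hV : ConditionV v) (h : roumieuSpace M v = projectiveSpace M v) :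
    (projectiveTopology M v).induced (LinearEquiv.ofEq _ _ h) ≤ roumieuTopology M v := by
  obtain ⟨ψ, hψ, hψ0⟩ := Submodule.exists_mem_ne_zero_of_ne_bot hS
  have hwin := isWindow_of_mem_beurlingSpace hM.1 hA hA2 hψ
  -- The infimum is tested against each competing topology `t`, whose continuous inclusions supply
  -- the radii `ε n`.
  refine le_sInf fun t ⟨_, _, _, htc⟩ => induced_iInf_seminormTopology_le
    (E := roumieuSpace M v) (F := projectiveSpace M v) (projectiveSeminorm M v) (LinearEquiv.ofEq _ _ h) fun U hU hUc => ?_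
  choose ε hε hεU using fun n => exists_seminorm_ball_subset_preimage
    (E := roumieuSpace M v) (G := roumieuStep M v n)
    (weightedSeminorm (stepCoeff M (1 / ((n : ℝ) + 1))) (v n)) (roumieuIncl M v n) (htc n) hU
  obtain ⟨r, hr, u, hu, κ, hdec⟩ := exists_decomposition hM hM1 hM2 hA hwin hψ0 hv hadm hV hε
  refine ⟨(⟨r, hr⟩, ⟨u, hu⟩), fun φ hφ => ?_⟩
  have hφ' := (projectiveSeminorm_le_iff zero_le_one).1 hφ
  rw [LinearEquiv.coe_ofEq_apply] at hφ'
  obtain ⟨N, f, hf, hsum⟩ := hdec φ.1 φ.2 hφ'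
  have hfmem : ∀ k, f k ∈ roumieuStep M v (κ k) := fun k =>
    mem_weightedSpace_iff.2 ⟨_, (hε _).le, hf k⟩
  have hfU : ∀ k, roumieuIncl M v (κ k) ⟨f k, hfmem k⟩ ∈ U := fun k =>
    hεU _ _ ((weightedSeminorm_le_iff (hε _).le).2 (hf k))
  have hconv := sum_half_pow_smul_mem hUc (mem_of_mem_nhds hU) hfU (N + 1)
  have heq : φ = ∑ k ∈ Finset.range (N + 1), ((1 / 2 : ℝ) ^ (k + 1)) •
      roumieuIncl M v (κ k) ⟨f k, hfmem k⟩ := by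
    refine Subtype.ext (Subtype.ext (funext fun x => ?_))
    rw [hsum x]
    simp only [AddSubmonoidClass.coe_finsetSum, Finset.sum_apply]
    exact Finset.sum_congr rfl fun k _ => rfl
  rw [heq]
  exact hconv

end

end GelfandShilov

open GelfandShilov
theorem mainTheorem1 (d : ℕ) (M A : ℕ → ℝ)
    (hM : IsWeightSequence M) (hM1 : ConditionM1 M) (hM2 : ConditionM2' M)
    (hA : IsWeightSequence A) (hA1 : ConditionM1 A) (hA2 : ConditionM2' A)
    (hS : beurlingSpace d M A ≠ ⊥)
    (v : ℕ → EuclideanSpace ℝ (Fin d) → ℝ) (hv : IsDecreasingWeightSystem v)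
    (hadm : IsAdmissible A v) (hV : ConditionV v) :
    ∃ h : roumieuSpace M v = projectiveSpace M v,
      roumieuTopology M v =
        (projectiveTopology M v).induced (LinearEquiv.ofEq _ _ h) := by
  have h := roumieuSpace_eq_projectiveSpace hM hv
  exact ⟨h, le_antisymm (roumieuTopology_le hM.1 hv h)
    (le_roumieuTopology hM hM1 hM2 hA hA2 hS hv hadm hV h)⟩
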